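/- Let $R$ be a subring of $\mathbb{Q}$. An $R$-module is $\aleph_1$-free if each of its countably generated submodules is free. A torsion-free $R$-module of finite rank is minimal non-free if it is not free but all its pure submodules of smaller rank are free. An $\aleph_1$-filtration of an $R$-module $G$ is an ascending continuous chain $(G_\alpha)_{\alpha<\omega_1}$ of countable, free, pure submodules of $G$ with $G_0=0$ and $\bigcup_{\alpha<\omega_1}G_\alpha=G$. Let $G$ be an $\aleph_1$-free $R$-module of cardinality $\aleph_1$. Then $G$ is of type I if it has an $\aleph_1$-filtration in which $G_{\alpha+1}/G_\alpha$ is minimal non-free for every $0<\alpha<\omega_1$; it is of type II if it has an $\aleph_1$-filtration in which $G/G_\alpha$ is $\aleph_1$-free for every $\alpha<\omega_1$ that is not a limit ordinal; and it is of type III if it is neither of type I nor of type II. Theorem (ZFC). If $G$ is an $R$-module of type III, then $G$ is not a splitter, that is, $\operatorname{Ext}_R(G,G)\neq 0$: there is a short exact sequence $0\to G\to X\to G\to 0$ of $R$-modules that does not split. -/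

import Mathlib

open scoped Cardinal Ordinal

universe u

/-- `G` is a splitter over `R`: every short exact sequence `0 → G → X → G → 0` of `R`-modules
splits (equivalently `Ext_R(G, G) = 0`). Any such `X` is in bijection with `G × G`, so it is no
restriction to take `X` in the universe of `G`. -/
def IsSplitter (R : Type) [CommRing R] (G : Type u) [AddCommGroup G] [Module R G] : Prop :=
  ∀ (X : Type u) [AddCommGroup X] [Module R X] (β : G →ₗ[R] X) (α : X →ₗ[R] G),
    Function.Injective β → Function.Exact β α → Function.Surjective α →
      ∃ γ : G →ₗ[R] X, α ∘ₗ γ = LinearMap.id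

/-- `M` is `ℵ₁`-free over `R`: every countably generated submodule is free. -/
def IsAlephOneFree (R : Type) [CommRing R] (M : Type u) [AddCommGroup M] [Module R M] : Prop :=
  ∀ S : Set M, S.Countable → Module.Free R (Submodule.span R S)

/-- `N` is a pure submodule of `M`: `N ∩ r M = r N` for all `r` in `R`
(for the principal ideal domains considered here this is the usual purity). -/
def IsPureSubmodule {R : Type} [CommRing R] {M : Type u} [AddCommGroup M] [Module R M]
    (N : Submodule R M) : Prop :=
  ∀ (r : R) (x : M), r • x ∈ N → ∃ y ∈ N, r • y = r • x

/-- `M` is minimal non-free: torsion-free of finite rank, not free, while all its pure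
submodules of smaller rank are free. -/
structure IsMinimalNonFree (R : Type) [CommRing R] (M : Type u) [AddCommGroup M] [Module R M] :
    Prop where
  torsionFree : Module.IsTorsionFree R M
  finiteRank : Module.rank R M < ℵ₀
  not_free : ¬ Module.Free R M
  free_of_rank_lt : ∀ N : Submodule R M, IsPureSubmodule N →
    Module.rank R N < Module.rank R M → Module.Free R N

/-- `F α` (`α < ω₁`) is an `ℵ₁`-filtration of `G`: an ascending continuous chain of countable,
free and pure submodules, starting at `0`, with union `G`. Only the values of `F` at countable
ordinals matter. -/
structure IsAlephOneFiltration {R : Type} [CommRing R] {G : Type u} [AddCommGroup G] [Module R G]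
    (F : Ordinal.{0} → Submodule R G) : Prop where
  zero : F 0 = ⊥
  mono : ∀ α β, α ≤ β → β < ω₁ → F α ≤ F β
  continuous : ∀ δ, δ < ω₁ → Order.IsSuccLimit δ → ∀ x, x ∈ F δ ↔ ∃ α < δ, x ∈ F α
  exhaustive : ∀ x, ∃ α < ω₁, x ∈ F α
  countable : ∀ α < ω₁, Countable (F α)
  free : ∀ α < ω₁, Module.Free R (F α)
  pure : ∀ α < ω₁, IsPureSubmodule (F α)

/-- `G` is of type I: it has an `ℵ₁`-filtration in which every quotient `F (α + 1) / F α` with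
`α > 0` is minimal non-free. The quotient is written as the image of `F (α + 1)` in `G / F α`. -/
def IsTypeI (R : Type) [CommRing R] (G : Type u) [AddCommGroup G] [Module R G] : Prop :=
  ∃ F : Ordinal.{0} → Submodule R G, IsAlephOneFiltration F ∧
    ∀ α, 0 < α → α < ω₁ → IsMinimalNonFree R ((F (Order.succ α)).map (F α).mkQ)

/-- `G` is of type II: it has an `ℵ₁`-filtration such that `G / F α` is `ℵ₁`-free for all
countable ordinals `α` that are not limit ordinals. -/
def IsTypeII (R : Type) [CommRing R] (G : Type u) [AddCommGroup G] [Module R G] : Prop :=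
  ∃ F : Ordinal.{0} → Submodule R G, IsAlephOneFiltration F ∧
    ∀ α < ω₁, ¬ Order.IsSuccLimit α → IsAlephOneFree R (G ⧸ F α)

/-- `G` is of type III: it is an `ℵ₁`-free module of cardinality `ℵ₁` that is neither of type I
nor of type II. -/
structure IsTypeIII (R : Type) [CommRing R] (G : Type u) [AddCommGroup G] [Module R G] :
    Prop where
  alephOneFree : IsAlephOneFree R G
  card_eq : #G = ℵ₁
  not_typeI : ¬ IsTypeI R G
  not_typeII : ¬ IsTypeII R G

/-! Let `G` be an ℵ₁-free splitter of cardinality ℵ₁; it is shown to be of type I or of type II. If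
every countable submodule lies in a countable `H` with `G / H` ℵ₁-free, a filtration through such
`H` gives type II. Otherwise some countable `C` has no countable `H ≥ C` with `G / H` ℵ₁-free.

Now consider the radical of `G / H`, the sum of its countable submodules with zero dual. If for some
countable `H` the radical is everything, then above `H` there is always a minimal non-free piece to
adjoin, and bookkeeping makes these pieces exhaust `G`: type I
(`isTypeI_of_countableRadical_eq_top`).

If this never happens, `G` is not a splitter. Let `V` be a divisible hull of `G`; a splitter lifts
every `f : G → V / G` to `V`. Along a filtration `F` an `f` is built such that, whenever `C ≤ F δ`,
its restriction to `F (δ + 1)` has no lift sending `F δ` into the divisible hull of `F δ`. A lift of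
`f` to all of `G` does send some such `F δ` into its hull, by closing off: a contradiction.

At stage `δ`, the module `G / F δ` contains a non-free `N` of finite rank, so `Ext (N, R) ≠ 0`.
Modulo its radical `G / F δ` is nonzero and ℵ₁-free, and this transports the obstruction to a map `ψ
: G → V / G` vanishing on `F δ` (`exists_obstruction`). One of `f`, `f + ψ` is not liftable in the
required way, since the difference of two lifts would lift `ψ`. All lifts are excluded at once, so
no prediction principle is needed and ZFC suffices. -/

/-! ### Divisible modules as injectives, and transfinite gluing of homomorphisms -/

section Baer

variable {R : Type*} [CommRing R] {M D : Type*} [AddCommGroup M] [Module R M]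
  [AddCommGroup D] [Module R D]

/-- Over a principal ideal domain divisible modules are injective. -/
theorem Module.Baer.of_forall_exists_smul_eq [IsDomain R] [IsPrincipalIdealRing R]
    (h : ∀ r : R, r ≠ 0 → ∀ x : D, ∃ y : D, r • y = x) : Module.Baer R D := by
  intro I g
  obtain ⟨a, ha⟩ := IsPrincipalIdealRing.principal I
  have haI : a ∈ I := by rw [ha]; exact Submodule.mem_span_singleton_self a
  by_cases ha0 : a = 0
  · refine ⟨0, fun x hx => ?_⟩
    have hx0 : x = 0 := by rw [ha, ha0] at hx; simpa using hx
    subst hx0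
    exact (map_zero g).symm
  · obtain ⟨y, hy⟩ := h a ha0 (g ⟨a, haI⟩)
    refine ⟨LinearMap.toSpanSingleton R D y, fun x hx => ?_⟩
    obtain ⟨c, rfl⟩ : ∃ c : R, c • a = x := by
      rw [ha] at hx; exact Submodule.mem_span_singleton.1 hx
    have : (⟨c • a, hx⟩ : I) = c • ⟨a, haI⟩ := rfl
    rw [this, LinearMap.toSpanSingleton_apply, smul_eq_mul, mul_smul, hy]
    exact (map_smul g c ⟨a, haI⟩).symm

theorem Module.Baer.exists_extend (hD : Module.Baer R D) (N : Submodule R M) (f : N →ₗ[R] D) :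
    ∃ g : M →ₗ[R] D, ∀ x : N, g x = f x := by
  obtain ⟨g, hg⟩ := hD.extension_property N.subtype N.injective_subtype f
  exact ⟨g, fun x => congrArg (fun φ => φ x) hg⟩

/-- Homomorphisms into an injective module which agree along a chain of submodules have a common
extension. -/
theorem Module.Baer.exists_glue {ι : Type*} [LinearOrder ι] (hD : Module.Baer R D)
    (B : ι → Submodule R M) (s : Set ι) (f : ι → M →ₗ[R] D)
    (hB : ∀ k ∈ s, ∀ l ∈ s, k < l → B k ≤ B l)
    (hf : ∀ k ∈ s, ∀ l ∈ s, k < l → ∀ x ∈ B k, f k x = f l x) :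
    ∃ g : M →ₗ[R] D, ∀ k ∈ s, ∀ x ∈ B k, g x = f k x := by
  -- The restrictions form a directed family of partial maps; injectivity of `D` extends their
  -- supremum to `M`.
  let p : ι → M →ₗ.[R] D := fun k => ⟨B k, (f k).domRestrict (B k)⟩
  have hle : ∀ k ∈ s, ∀ l ∈ s, k < l → p k ≤ p l := by
    intro k hk l hl hkl
    refine ⟨hB k hk l hl hkl, ?_⟩
    rintro ⟨x, hx⟩ ⟨y, hy⟩ hxy
    obtain rfl : x = y := hxy
    exact hf k hk l hl hkl x hx
  have hc : DirectedOn (· ≤ ·) (p '' s) := by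
    rintro _ ⟨k, hk, rfl⟩ _ ⟨l, hl, rfl⟩
    rcases lt_trichotomy k l with h | h | h
    · exact ⟨p l, ⟨l, hl, rfl⟩, hle k hk l hl h, le_rfl⟩
    · exact ⟨p l, ⟨l, hl, rfl⟩, h ▸ le_rfl, le_rfl⟩
    · exact ⟨p k, ⟨k, hk, rfl⟩, le_rfl, hle l hl k hk h⟩
  obtain ⟨g, hg⟩ := hD.exists_extend _ (LinearPMap.sSup (p '' s) hc).toFun
  refine ⟨g, fun k hk x hx => ?_⟩
  have hkc : p k ∈ p '' s := ⟨k, hk, rfl⟩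
  have h1 := hg ⟨x, (LinearPMap.le_sSup hc hkc).1 hx⟩
  exact h1.trans (LinearPMap.sSup_apply hc hkc ⟨x, hx⟩)

/-- If every homomorphism into the injective module `D` can be changed outside of `A i` so as to
satisfy `P i`, a property depending on the values on `B i` only, then some homomorphism satisfies
all of them. -/
theorem Module.Baer.exists_forall {ι : Type*} [LinearOrder ι] [WellFoundedLT ι]
    (hD : Module.Baer R D) (A B : ι → Submodule R M)
    (hAB : ∀ i, A i ≤ B i) (hBA : ∀ k i, k < i → B k ≤ A i)
    (P : ι → (M →ₗ[R] D) → Prop)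
    (hP : ∀ i (f g : M →ₗ[R] D), (∀ x ∈ B i, f x = g x) → P i f → P i g)
    (hstep : ∀ i (f : M →ₗ[R] D), ∃ g : M →ₗ[R] D, (∀ x ∈ A i, f x = g x) ∧ P i g) :
    ∃ f : M →ₗ[R] D, ∀ i, P i f := by
  classical
  choose step hstep hPstep using hstep
  -- The value `0` is never used: `key` below shows that the maps chosen before `i` are always
  -- compatible.
  let glue : (i : ι) → ((k : ι) → k < i → M →ₗ[R] D) → (M →ₗ[R] D) := fun i F =>
    if h : ∃ g : M →ₗ[R] D, ∀ k (hk : k < i), ∀ x ∈ B k, g x = F k hk x then h.choose else 0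
  let F : ι → M →ₗ[R] D := (wellFounded_lt (α := ι)).fix fun i F => step i (glue i F)
  have hF : ∀ i, F i = step i (glue i fun k _ => F k) := fun i =>
    (wellFounded_lt (α := ι)).fix_eq _ i
  have hBB : ∀ k l, k < l → B k ≤ B l := fun k l h => (hBA k l h).trans (hAB l)
  have key : ∀ i, ∀ k < i, ∀ x ∈ B k, F k x = F i x := by
    intro i
    induction i using WellFoundedLT.induction with
    | ind i ih =>
      have hex : ∃ g : M →ₗ[R] D, ∀ k (hk : k < i), ∀ x ∈ B k, g x = F k x := by
        obtain ⟨g, hg⟩ := hD.exists_glue B (Set.Iio i) F (fun k _ l _ h => hBB k l h)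
          (fun k _ l hl h x hx => ih l hl k h x hx)
        exact ⟨g, fun k hk => hg k hk⟩
      intro k hk x hx
      rw [hF i, ← hstep i _ x (hBA k i hk hx)]
      simp only [glue, dif_pos hex]
      exact (hex.choose_spec k hk x hx).symm
  obtain ⟨f, hf⟩ := hD.exists_glue B Set.univ F (fun k _ l _ h => hBB k l h)
    (fun k _ l _ h x hx => key l k h x hx)
  refine ⟨f, fun i => hP i (F i) f (fun x hx => (hf i trivial x hx).symm) ?_⟩
  rw [hF i]
  exact hPstep i _

end Baer

/-! ### Countability of submodules -/

section Countable

variable {R : Type} [CommRing R] {M : Type*} [AddCommGroup M] [Module R M]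

theorem countable_sup (N N' : Submodule R M) [Countable N] [Countable N'] :
    Countable (N ⊔ N' : Submodule R M) := by
  refine Function.Surjective.countable (f := fun p : N × N' =>
    (⟨(p.1 : M) + p.2, Submodule.add_mem_sup p.1.2 p.2.2⟩ : (N ⊔ N' : Submodule R M))) ?_
  rintro ⟨x, hx⟩
  obtain ⟨y, hy, z, hz, rfl⟩ := Submodule.mem_sup.1 hx
  exact ⟨(⟨y, hy⟩, ⟨z, hz⟩), rfl⟩

theorem countable_span [Countable R] {S : Set M} (hS : S.Countable) :
    Countable (Submodule.span R S) := by
  have := hS.to_subtype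
  have h : Set.range (Finsupp.linearCombination R ((↑) : S → M)) = Submodule.span R S := by
    rw [← LinearMap.coe_range, Finsupp.range_linearCombination, Subtype.range_coe]
  exact (h ▸ Set.countable_range _ : (Submodule.span R S : Set M).Countable).to_subtype

theorem countable_iSup [Countable R] {ι : Type*} [Countable ι] (N : ι → Submodule R M)
    (h : ∀ i, Countable (N i)) : Countable (⨆ i, N i : Submodule R M) := by
  rw [Submodule.iSup_eq_span]
  exact countable_span (Set.countable_iUnion fun i => (Set.to_countable (N i : Set M)))

theorem countable_comap_mkQ (K : Submodule R M) [Countable K] (N : Submodule R (M ⧸ K))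
    [Countable N] : Countable (N.comap K.mkQ) := by
  choose s hs using K.mkQ_surjective
  refine Function.Injective.countable (f := fun x : N.comap K.mkQ =>
    ((⟨K.mkQ x, x.2⟩ : N), (⟨x - s (K.mkQ x), by
      rw [← Submodule.Quotient.mk_eq_zero, ← Submodule.mkQ_apply, map_sub, hs, sub_self]⟩ : K))) ?_
  intro x y hxy
  simp only [Prod.mk.injEq, Subtype.mk.injEq] at hxy
  rw [← hxy.1] at hxy
  exact Subtype.ext (sub_left_injective hxy.2)

end Countable

/-! ### Purity and pure closures -/

section Pure

theorem isPureSubmodule_of_forall {R : Type} [CommRing R] {M : Type u} [AddCommGroup M] [Module R M]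
    {N : Submodule R M}
    (h : ∀ (r : R) (x : M), r ≠ 0 → r • x ∈ N → x ∈ N) : IsPureSubmodule N := by
  intro r x hx
  by_cases hr : r = 0
  · exact ⟨0, N.zero_mem, by simp [hr]⟩
  · exact ⟨x, h r x hr hx, rfl⟩

variable {R : Type} [CommRing R] [IsDomain R] {M : Type u} [AddCommGroup M] [Module R M]

/-- The elements of `M` with a nonzero multiple in `N`. -/
def pureClosure (N : Submodule R M) : Submodule R M where
  carrier := {x | ∃ r : R, r ≠ 0 ∧ r • x ∈ N}
  zero_mem' := ⟨1, one_ne_zero, by simp⟩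
  add_mem' := by
    rintro x y ⟨r, hr, hx⟩ ⟨s, hs, hy⟩
    refine ⟨r * s, mul_ne_zero hr hs, ?_⟩
    rw [smul_add, mul_comm r s, mul_smul, mul_comm s r, mul_smul]
    exact N.add_mem (N.smul_mem _ hx) (N.smul_mem _ hy)
  smul_mem' := by
    rintro c x ⟨r, hr, hx⟩
    exact ⟨r, hr, by rw [smul_comm]; exact N.smul_mem _ hx⟩

theorem le_pureClosure (N : Submodule R M) : N ≤ pureClosure N := fun x hx =>
  ⟨1, one_ne_zero, by simpa using hx⟩

theorem pureClosure_mono {N N' : Submodule R M} (h : N ≤ N') : pureClosure N ≤ pureClosure N' := by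
  rintro x ⟨r, hr, hx⟩
  exact ⟨r, hr, h hx⟩

theorem mem_pureClosure_of_smul_mem {N : Submodule R M} {r : R} (hr : r ≠ 0) {x : M}
    (h : r • x ∈ pureClosure N) : x ∈ pureClosure N := by
  obtain ⟨s, hs, hx⟩ := h
  exact ⟨s * r, mul_ne_zero hs hr, by rwa [mul_smul]⟩

theorem isPureSubmodule_pureClosure (N : Submodule R M) : IsPureSubmodule (pureClosure N) :=
  isPureSubmodule_of_forall fun _ _ hr h => mem_pureClosure_of_smul_mem hr h

theorem IsPureSubmodule.mem_of_smul_mem [Module.IsTorsionFree R M] {N : Submodule R M}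
    (hN : IsPureSubmodule N) {r : R} (hr : r ≠ 0) {x : M} (h : r • x ∈ N) : x ∈ N := by
  obtain ⟨y, hy, hxy⟩ := hN r x h
  rwa [← smul_right_injective M hr hxy]

theorem IsPureSubmodule.pureClosure_le [Module.IsTorsionFree R M] {N N' : Submodule R M}
    (hN : IsPureSubmodule N) (h : N' ≤ N) : pureClosure N' ≤ N := by
  rintro x ⟨r, hr, hx⟩
  exact hN.mem_of_smul_mem hr (h hx)

theorem IsPureSubmodule.isTorsionFree_quotient [Module.IsTorsionFree R M] {N : Submodule R M}
    (hN : IsPureSubmodule N) : Module.IsTorsionFree R (M ⧸ N) := by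
  refine Module.isTorsionFree_iff_smul_eq_zero.2 fun r x hx => ?_
  obtain ⟨x, rfl⟩ := N.mkQ_surjective x
  by_cases hr : r = 0
  · exact Or.inl hr
  · right
    rw [← map_smul, Submodule.mkQ_apply, Submodule.Quotient.mk_eq_zero] at hx
    rw [Submodule.mkQ_apply, Submodule.Quotient.mk_eq_zero]
    exact hN.mem_of_smul_mem hr hx

theorem isPureSubmodule_of_isTorsionFree_quotient {N : Submodule R M}
    [Module.IsTorsionFree R (M ⧸ N)] : IsPureSubmodule N := by
  refine isPureSubmodule_of_forall fun r x hr hx => ?_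
  rw [← Submodule.Quotient.mk_eq_zero, Submodule.Quotient.mk_smul] at hx
  rw [← Submodule.Quotient.mk_eq_zero]
  exact (smul_eq_zero.1 hx).resolve_left hr

theorem countable_pureClosure [Countable R] [Module.IsTorsionFree R M] (N : Submodule R M)
    [Countable N] : Countable (pureClosure N) := by
  choose r hr h using fun x : pureClosure N => x.2
  refine Function.Injective.countable (f := fun x => (r x, (⟨r x • (x : M), h x⟩ : N))) ?_
  intro x y hxy
  simp only [Prod.mk.injEq, Subtype.mk.injEq] at hxy
  rw [← hxy.1] at hxy
  exact Subtype.ext (smul_right_injective M (hr x) hxy.2)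

theorem IsPureSubmodule.comap {M' : Type*} [AddCommGroup M'] [Module R M'] [Module.IsTorsionFree R M']
    {N : Submodule R M'} (hN : IsPureSubmodule N) (f : M →ₗ[R] M') :
    IsPureSubmodule (N.comap f) :=
  isPureSubmodule_of_forall fun r x hr h => hN.mem_of_smul_mem hr (by simpa using h)

end Pure

/-! ### Free extensions and unions of chains -/

section FreeExtensions

variable {R : Type} [CommRing R] {M : Type u} [AddCommGroup M] [Module R M]

/-- A basis of a submodule `A ≤ B` with `B / A` free extends to a basis of `B`. -/
theorem exists_linearIndepOn_extend {A B : Submodule R M} (hAB : A ≤ B)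
    [Module.Free R (B ⧸ A.submoduleOf B)] {b : Set M} (hb : LinearIndepOn R id b)
    (hbA : Submodule.span R b = A) :
    ∃ c : Set M, b ⊆ c ∧ LinearIndepOn R id c ∧ Submodule.span R c = B := by
  have hr : Submodule.span R (Set.range ((↑) : b → M)) = A := by rw [Subtype.range_coe, hbA]
  let bA : Module.Basis b R A := (Module.Basis.span (v := ((↑) : b → M)) hb).map
    (LinearEquiv.ofEq _ _ hr)
  have hbA' : ∀ i : b, (bA i : M) = i := fun i => by
    simp only [bA, Module.Basis.map_apply, LinearEquiv.coe_ofEq_apply]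
    exact congrArg Subtype.val (Module.Basis.span_apply hb i)
  let bW := bA.map (Submodule.submoduleOfEquivOfLe hAB).symm
  have hbW : ∀ i : b, ((bW i : B) : M) = i := fun i => by
    rw [← hbA' i]; rfl
  let bQ := Module.Free.chooseBasis R (B ⧸ A.submoduleOf B)
  let bB := Module.Basis.sumQuot bW bQ
  refine ⟨Set.range fun i => (bB i : M), ?_, ?_, ?_⟩
  · intro x hx
    refine ⟨Sum.inl ⟨x, hx⟩, ?_⟩
    simp only [bB, Module.Basis.sumQuot_inl]
    exact hbW ⟨x, hx⟩
  · exact (bB.linearIndependent.map' B.subtype (Submodule.ker_subtype B)).linearIndepOn_id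
  · have : (Set.range fun i => (bB i : M)) = B.subtype '' Set.range bB := by
      rw [← Set.range_comp]; rfl
    rw [this, Submodule.span_image, bB.span_eq, Submodule.map_subtype_top]

theorem Module.Free.of_quotient (N : Submodule R M) [Module.Free R N] [Module.Free R (M ⧸ N)] :
    Module.Free R M :=
  .of_basis (Module.Basis.sumQuot (Module.Free.chooseBasis R N) (Module.Free.chooseBasis R (M ⧸ N)))

/-- The union of a chain of submodules with free successive quotients is free. -/
theorem Module.Free.of_chain (P : ℕ → Submodule R M) (h0 : P 0 = ⊥) (hP : ∀ n, P n ≤ P (n + 1))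
    (hfree : ∀ n, Module.Free R (P (n + 1) ⧸ (P n).submoduleOf (P (n + 1))))
    (htop : ∀ x, ∃ n, x ∈ P n) : Module.Free R M := by
  -- Bases of the `P n` are chosen nested, so that their union is a basis of `M`.
  let T : ℕ → Type u := fun n =>
    {b : Set M // LinearIndepOn R id b ∧ Submodule.span R b = P n}
  have hext : ∀ n (b : T n), ∃ c : T (n + 1), b.1 ⊆ c.1 := by
    rintro n ⟨b, hb, hbP⟩
    have := hfree n
    obtain ⟨c, hbc, hc, hcP⟩ := exists_linearIndepOn_extend (hP n) hb hbP
    exact ⟨⟨c, hc, hcP⟩, hbc⟩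
  choose next hnext using hext
  let b : ∀ n, T n := fun n => Nat.rec ⟨∅, linearIndepOn_empty _ _, by simp [h0]⟩ next n
  have hb : ∀ n, (b n).1 ⊆ (b (n + 1)).1 := fun n => hnext n (b n)
  have hmono : Monotone fun n => (b n).1 := monotone_nat_of_le_succ hb
  have hli : LinearIndepOn R id (⋃ n, (b n).1) :=
    linearIndepOn_iUnion_of_directed hmono.directed_le fun n => (b n).2.1
  refine Module.Free.of_basis (Module.Basis.mk (v := ((↑) : (⋃ n, (b n).1 : Set M) → M)) hli ?_)
  intro x _
  obtain ⟨n, hn⟩ := htop x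
  rw [← (b n).2.2] at hn
  rw [Subtype.range_coe]
  exact Submodule.span_mono (Set.subset_iUnion (fun n => (b n).1) n) hn

end FreeExtensions

/-! ### Rank and modules of finite rank -/

section Rank

variable {R : Type} [CommRing R] [IsDomain R] {M : Type u} [AddCommGroup M] [Module R M]

theorem rank_quotient_submoduleOf_add (N P : Submodule R M) (h : N ≤ P) :
    Module.rank R (P ⧸ N.submoduleOf P) + Module.rank R N = Module.rank R P := by
  rw [← rank_quotient_add_rank_of_isDomain (N.submoduleOf P),
    (Submodule.submoduleOfEquivOfLe h).rank_eq]

theorem rank_pureClosure (N : Submodule R M) :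
    Module.rank R (pureClosure N) = Module.rank R N := by
  rw [← rank_quotient_submoduleOf_add N _ (le_pureClosure N)]
  have : Module.rank R (pureClosure N ⧸ N.submoduleOf (pureClosure N)) = 0 := by
    rw [rank_eq_zero_iff]
    intro x
    obtain ⟨⟨x, r, hr, hx⟩, rfl⟩ := Submodule.mkQ_surjective _ x
    exact ⟨r, hr, by
      rw [← map_smul, Submodule.mkQ_apply, Submodule.Quotient.mk_eq_zero]; exact hx⟩
  rw [this, zero_add]

theorem rank_span_finite {s : Set M} (hs : s.Finite) : Module.rank R (Submodule.span R s) < ℵ₀ :=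
  (rank_span_le s).trans_lt (Cardinal.lt_aleph0_iff_set_finite.2 hs)

/-- A maximal independent set is finite and spans a submodule of full rank. Finite ranks cancel, so
the quotient has rank zero and is torsion. -/
theorem exists_fg_of_rank_lt (h : Module.rank R M < ℵ₀) :
    ∃ A : Submodule R M, A.FG ∧ ∀ x, ∃ r : R, r ≠ 0 ∧ r • x ∈ A := by
  obtain ⟨s, hs, hli⟩ := exists_set_linearIndependent R M
  have hfin : s.Finite := Cardinal.lt_aleph0_iff_set_finite.1 (hs ▸ h)
  refine ⟨Submodule.span R s, Submodule.fg_span hfin, fun x => ?_⟩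
  have h1 := rank_quotient_add_rank_of_isDomain (Submodule.span R s)
  have h2 : Module.rank R (Submodule.span R s) = Module.rank R M := by
    rw [← hs]; exact rank_span_set hli
  rw [h2] at h1
  have h3 : Module.rank R (M ⧸ Submodule.span R s) = 0 := by
    obtain ⟨a, ha⟩ := Cardinal.lt_aleph0.1 h
    rw [ha] at h1
    have h4 : Module.rank R (M ⧸ Submodule.span R s) < ℵ₀ := by
      refine lt_of_le_of_lt (le_of_le_of_eq (self_le_add_right _ _) h1) (Cardinal.natCast_lt_aleph0)
    obtain ⟨c, hc⟩ := Cardinal.lt_aleph0.1 h4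
    rw [hc] at h1 ⊢
    norm_cast at h1 ⊢
    omega
  obtain ⟨r, hr, hrx⟩ := rank_eq_zero_iff.1 h3 ((Submodule.span R s).mkQ x)
  refine ⟨r, hr, ?_⟩
  rwa [← map_smul, Submodule.mkQ_apply, Submodule.Quotient.mk_eq_zero] at hrx

/-- A map into a torsion-free module is determined by its values on finitely many generators of a
full lattice. Countability lets the diagonal argument in `exists_not_liftable` treat all candidate
lifts in a sequence. -/
theorem countable_linearMap_fractionRing [Countable R] (h : Module.rank R M < ℵ₀) :
    Countable (M →ₗ[R] FractionRing R) := by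
  have : Countable (FractionRing R) :=
    (IsLocalization.mk'_surjective (nonZeroDivisors R)
      (S := FractionRing R)).countable
  obtain ⟨A, ⟨s, rfl⟩, hA⟩ := exists_fg_of_rank_lt h
  refine Function.Injective.countable (f := fun (g : M →ₗ[R] FractionRing R) (i : s) => g i) ?_
  intro f g hfg
  have hs : ∀ x ∈ Submodule.span R (s : Set M), f x = g x := by
    have : Set.EqOn f g s := fun x hx => congrFun hfg ⟨x, hx⟩
    exact fun x hx => LinearMap.eqOn_span this hx
  ext x
  obtain ⟨r, hr, hx⟩ := hA x
  have := hs _ hx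
  rw [map_smul, map_smul] at this
  exact smul_right_injective _ hr this

theorem IsPureSubmodule.map_subtype [Module.IsTorsionFree R M] {P : Submodule R M}
    (hP : IsPureSubmodule P) {N : Submodule R P} (hN : IsPureSubmodule N) :
    IsPureSubmodule (N.map P.subtype) := by
  refine isPureSubmodule_of_forall fun r x hr hx => ?_
  obtain ⟨y, hy, hxy⟩ := hx
  have hxP : x ∈ P := hP.mem_of_smul_mem hr (hxy ▸ y.2)
  refine ⟨⟨x, hxP⟩, hN.mem_of_smul_mem hr ?_, rfl⟩
  have : r • (⟨x, hxP⟩ : P) = y := Subtype.ext hxy.symm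
  rwa [this]

end Rank

/-! ### Pontryagin's criterion and minimal non-free modules -/

section Pontryagin

variable {R : Type} [CommRing R] [IsDomain R] [IsPrincipalIdealRing R]
  {M : Type u} [AddCommGroup M] [Module R M]

/-- Pontryagin's criterion. -/
theorem Module.Free.of_countable_of_forall_pureClosure [Module.IsTorsionFree R M] [Countable M]
    (h : ∀ s : Set M, s.Finite → Module.Free R (pureClosure (Submodule.span R s))) :
    Module.Free R M := by
  obtain ⟨x, hx⟩ := exists_surjective_nat M
  let P : ℕ → Submodule R M := fun n => pureClosure (Submodule.span R (x '' Set.Iio n))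
  have hfin : ∀ n : ℕ, (x '' Set.Iio n).Finite := fun n => (Set.finite_Iio n).image x
  have hP : ∀ n, P n ≤ P (n + 1) := fun n => pureClosure_mono (Submodule.span_mono
    (Set.image_mono (Set.Iio_subset_Iio n.le_succ)))
  refine Module.Free.of_chain P ?_ hP (fun n => ?_) fun y => ?_
  · rw [eq_bot_iff]
    refine IsPureSubmodule.pureClosure_le (isPureSubmodule_of_forall fun r x hr hx => ?_) ?_
    · rw [Submodule.mem_bot] at hx ⊢
      exact (smul_eq_zero.1 hx).resolve_left hr
    · simp
  -- `P (n + 1)` is free of finite rank, hence finitely generated; its quotient by the pure `P n` is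
  -- finitely generated and torsion-free, so free over a principal ideal domain.
  · have h1 := h _ (hfin (n + 1))
    have h2 : Module.Finite R (P (n + 1)) := by
      have h1' : Module.Free R (P (n + 1)) := h1
      rw [← Module.rank_lt_aleph0_iff, rank_pureClosure]
      exact rank_span_finite (hfin (n + 1))
    have h3 : Module.IsTorsionFree R (P (n + 1) ⧸ (P n).submoduleOf (P (n + 1))) :=
      ((isPureSubmodule_pureClosure _).comap (P (n + 1)).subtype).isTorsionFree_quotient
    infer_instance
  · obtain ⟨n, rfl⟩ := hx y
    exact ⟨n + 1, le_pureClosure _ (Submodule.subset_span ⟨n, n.lt_succ_self, rfl⟩)⟩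

/-- The pure closure of a countable submodule that is not free contains a minimal non-free pure
submodule. -/
theorem exists_isMinimalNonFree [Module.IsTorsionFree R M] (C : Submodule R M) [Countable C]
    (hC : ¬ Module.Free R C) :
    ∃ N : Submodule R M, IsPureSubmodule N ∧ N ≤ pureClosure C ∧ IsMinimalNonFree R N := by
  let Q : Set (Submodule R M) := {N | IsPureSubmodule N ∧ N ≤ pureClosure C ∧
    Module.rank R N < ℵ₀ ∧ ¬ Module.Free R N}
  have hQ : Q.Nonempty := by
    by_contra hne
    refine hC (Module.Free.of_countable_of_forall_pureClosure fun s hs => ?_)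
    -- `C` need not be pure, so this closure, taken inside `C`, may be smaller than the one in `M`.
    -- The latter is free of finite rank, and freeness passes to submodules.
    let P := pureClosure (Submodule.span R s)
    let P' := P.map C.subtype
    have hrank : Module.rank R P' < ℵ₀ := by
      rw [← (Submodule.equivMapOfInjective C.subtype C.injective_subtype P).rank_eq,
        rank_pureClosure]
      exact rank_span_finite hs
    have hfree : Module.Free R (pureClosure P') := by
      by_contra hnf
      exact hne ⟨pureClosure P', isPureSubmodule_pureClosure _,
        pureClosure_mono (Submodule.map_subtype_le C P), by rwa [rank_pureClosure], hnf⟩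
    have hfin : Module.Finite R (pureClosure P') := by
      rwa [← Module.rank_lt_aleph0_iff, rank_pureClosure]
    have : Module.Finite R P' := by
      have : IsNoetherian R (pureClosure P') := inferInstance
      exact Module.Finite.of_injective (Submodule.inclusion (le_pureClosure P'))
        (Submodule.inclusion_injective _)
    have : Module.Free R P' := inferInstance
    exact Module.Free.of_equiv
      (Submodule.equivMapOfInjective C.subtype C.injective_subtype P).symm
  -- A non-free pure submodule of least rank is minimal non-free.
  obtain ⟨N, ⟨hN, hNC, hNr, hNf⟩, hmin⟩ :=
    (InvImage.wf (fun N : Submodule R M => Module.rank R N) Cardinal.lt_wf).has_min Q hQ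
  refine ⟨N, hN, hNC, inferInstance, hNr, hNf, fun L hL hLN => ?_⟩
  have e := Submodule.equivMapOfInjective N.subtype N.injective_subtype L
  by_contra hLf
  refine hmin (L.map N.subtype) ⟨hN.map_subtype hL,
    (Submodule.map_subtype_le N L).trans hNC, ?_, fun hf => hLf ?_⟩ ?_
  · rw [← e.rank_eq]; exact hLN.trans hNr
  · exact Module.Free.of_equiv e.symm
  · change Module.rank R (L.map N.subtype) < Module.rank R N
    rwa [← e.rank_eq]

/-- The kernel of a nonzero functional is pure of smaller rank, hence free, and its image is an
ideal, hence free too; together they would make `M` free. -/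
theorem IsMinimalNonFree.eq_zero (hM : IsMinimalNonFree R M) (φ : M →ₗ[R] R) : φ = 0 := by
  by_contra hφ
  have := hM.torsionFree
  have hker : IsPureSubmodule (LinearMap.ker φ) := isPureSubmodule_of_forall fun r x hr hx => by
    simpa [hr] using hx
  have hsum := rank_quotient_add_rank_of_isDomain (LinearMap.ker φ)
  have hne : Module.rank R (M ⧸ LinearMap.ker φ) ≠ 0 := by
    obtain ⟨x, hx⟩ : ∃ x, φ x ≠ 0 := by
      by_contra! h
      exact hφ (LinearMap.ext h)
    intro h
    obtain ⟨r, hr, hrx⟩ := rank_eq_zero_iff.1 h ((LinearMap.ker φ).mkQ x)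
    rw [← map_smul, Submodule.mkQ_apply, Submodule.Quotient.mk_eq_zero, LinearMap.mem_ker,
      map_smul] at hrx
    exact hx ((smul_eq_zero.1 hrx).resolve_left hr)
  have hlt : Module.rank R (LinearMap.ker φ) < Module.rank R M := by
    have hfin := hM.finiteRank
    rw [← hsum] at hfin ⊢
    obtain ⟨h1, h2⟩ := Cardinal.add_lt_aleph0_iff.1 hfin
    obtain ⟨a, ha⟩ := Cardinal.lt_aleph0.1 h1
    obtain ⟨b, hb⟩ := Cardinal.lt_aleph0.1 h2
    rw [ha] at hne
    rw [ha, hb]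
    norm_cast
    have : a ≠ 0 := by exact_mod_cast hne
    omega
  have h1 := hM.free_of_rank_lt _ hker hlt
  have h2 : Module.Free R (M ⧸ LinearMap.ker φ) := by
    have : Module.Free R (LinearMap.range φ) := inferInstance
    exact Module.Free.of_equiv φ.quotKerEquivRange.symm
  exact hM.not_free (Module.Free.of_quotient (LinearMap.ker φ))

end Pontryagin

/-! ### Non-vanishing of `Ext (N, R)` for non-free `N` of finite rank -/

section Ext

variable {R : Type} [CommRing R] [IsDomain R]

/-- The canonical copy of `R` in its field of fractions. -/
abbrev fractionRingOne (R : Type) [CommRing R] : Submodule R (FractionRing R) :=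
  LinearMap.range (Algebra.linearMap R (FractionRing R))

theorem fractionRing_exists_smul_eq (r : R) (hr : r ≠ 0) (x : FractionRing R) :
    ∃ y : FractionRing R, r • y = x := by
  have : algebraMap R (FractionRing R) r ≠ 0 := by simpa using hr
  exact ⟨(algebraMap R (FractionRing R) r)⁻¹ * x, by
    rw [Algebra.smul_def, mul_inv_cancel_left₀ this]⟩

variable [IsPrincipalIdealRing R]

theorem baer_fractionRing : Module.Baer R (FractionRing R) :=
  .of_forall_exists_smul_eq fractionRing_exists_smul_eq

theorem baer_quotient {V : Type*} [AddCommGroup V] [Module R V]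
    (h : ∀ r : R, r ≠ 0 → ∀ x : V, ∃ y : V, r • y = x) (W : Submodule R V) :
    Module.Baer R (V ⧸ W) :=
  .of_forall_exists_smul_eq fun r hr x => by
    obtain ⟨x, rfl⟩ := W.mkQ_surjective x
    obtain ⟨y, rfl⟩ := h r hr x
    exact ⟨W.mkQ y, (map_smul _ _ _).symm⟩

variable {N : Type u} [AddCommGroup N] [Module R N] [Module.IsTorsionFree R N]

/-- A full lattice `P` in `N` is separated from each element outside of it by a rational functional
which is integral on `P`. -/
theorem exists_functional_of_notMem (P : Submodule R N) (hfg : P.FG)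
    (hP : ∀ x, ∃ r : R, r ≠ 0 ∧ r • x ∈ P) {y : N} (hy : y ∉ P) :
    ∃ u : N →ₗ[R] FractionRing R, (∀ x ∈ P, u x ∈ fractionRingOne R) ∧
      u y ∉ fractionRingOne R := by
  have : Module.Finite R P := Module.Finite.iff_fg.2 hfg
  let b := Module.Free.chooseBasis R P
  -- The coordinate functionals of `P`, extended rationally to `N`, suffice: if all are integral at
  -- `y`, their values are the coordinates of `y`, and `y ∈ P`.
  choose u hu using fun i => baer_fractionRing.exists_extend P
    ((Algebra.linearMap R (FractionRing R)) ∘ₗ b.coord i)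
  by_contra! hcon
  have hint : ∀ i, ∃ c : R, algebraMap R (FractionRing R) c = u i y := fun i =>
    hcon (u i) fun x hx => ⟨b.coord i ⟨x, hx⟩, (hu i ⟨x, hx⟩).symm⟩
  choose c hc using hint
  obtain ⟨m, hm, hmy⟩ := hP y
  have key : (⟨m • y, hmy⟩ : P) = m • ∑ i, c i • b i := by
    apply b.ext_elem
    intro i
    have h1 := hu i ⟨m • y, hmy⟩
    rw [map_smul, ← hc i, Algebra.smul_def, ← map_mul] at h1
    have h2 := IsFractionRing.injective R (FractionRing R) h1
    rw [map_smul, Finsupp.smul_apply, b.repr_sum_self, smul_eq_mul, h2]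
    rfl
  have h3 : m • y = m • ((∑ i, c i • b i : P) : N) := congrArg Subtype.val key
  exact hy (smul_right_injective N hm h3 ▸ (∑ i, c i • b i : P).2)

/-- If `N` is a countable torsion-free module of finite rank which is not free, then
`Ext (N, R) ≠ 0`. -/
theorem exists_not_liftable [Countable R] (h : Module.rank R N < ℵ₀)
    (hN : ¬ Module.Free R N) :
    ∃ φ : N →ₗ[R] FractionRing R ⧸ fractionRingOne R,
      ¬ ∃ g : N →ₗ[R] FractionRing R, ∀ x, (fractionRingOne R).mkQ (g x) = φ x := by
  have := countable_linearMap_fractionRing h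
  obtain ⟨g, hg⟩ := exists_surjective_nat (N →ₗ[R] FractionRing R)
  obtain ⟨A, hAfg, hA⟩ := exists_fg_of_rank_lt h
  have hnot : ∀ P : Submodule R N, P.FG → ∃ y, y ∉ P := by
    intro P hP
    by_contra! hall
    have : P = ⊤ := eq_top_iff.2 fun y _ => hall y
    have : Module.Finite R N := ⟨this ▸ hP⟩
    exact hN inferInstance
  let T := {P : Submodule R N // P.FG ∧ A ≤ P}
  choose y hy using fun P : T => hnot P.1 P.2.1
  let next : T → T := fun P => ⟨P.1 ⊔ Submodule.span R {y P},
    P.2.1.sup (Submodule.fg_span_singleton _), P.2.2.trans le_sup_left⟩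
  let P : ℕ → T := fun n => Nat.rec ⟨A, hAfg, le_rfl⟩ (fun _ => next) n
  have hle : ∀ n, (P n).1 ≤ (P (n + 1)).1 := fun n => le_sup_left
  have hmono : Monotone fun n => (P n).1 := monotone_nat_of_le_succ hle
  have hD : Module.Baer R (FractionRing R ⧸ fractionRingOne R) :=
    baer_quotient fractionRing_exists_smul_eq _
  -- Diagonalization: on `P (n + 1)`, which contains a new element outside `P n`, the map `φ` is
  -- made to differ from the reduction of the `n`-th rational map, without changing it on `P n`.
  obtain ⟨φ, hφ⟩ := hD.exists_forall (fun n => (P n).1) (fun n => (P (n + 1)).1) hle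
    (fun k i hki => hmono hki)
    (fun n f => ¬ ∀ x ∈ (P (n + 1)).1, (fractionRingOne R).mkQ (g n x) = f x)
    (fun n f f' hff hf hf' => hf fun x hx => (hf' x hx).trans (hff x hx).symm)
    (fun n f => by
      by_cases hf : ∀ x ∈ (P (n + 1)).1, (fractionRingOne R).mkQ (g n x) = f x
      · obtain ⟨u, hu, huy⟩ := exists_functional_of_notMem (P n).1 (P n).2.1
          (fun x => (hA x).imp fun r hr => ⟨hr.1, (P n).2.2 hr.2⟩) (hy (P n))
        refine ⟨f + (fractionRingOne R).mkQ ∘ₗ u, fun x hx => ?_, fun hall => huy ?_⟩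
        · have : (fractionRingOne R).mkQ (u x) = 0 := by
            rw [Submodule.mkQ_apply, Submodule.Quotient.mk_eq_zero]; exact hu x hx
          rw [LinearMap.add_apply, LinearMap.comp_apply, this, add_zero]
        · have hmem : y (P n) ∈ (P (n + 1)).1 :=
            Submodule.mem_sup_right (Submodule.mem_span_singleton_self _)
          have h1 := hall _ hmem
          rw [hf _ hmem, LinearMap.add_apply, left_eq_add, LinearMap.comp_apply,
            Submodule.mkQ_apply, Submodule.Quotient.mk_eq_zero] at h1
          exact h1
      · exact ⟨f, fun _ _ => rfl, hf⟩)
  refine ⟨φ, ?_⟩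
  rintro ⟨f, hf⟩
  obtain ⟨n, rfl⟩ := hg f
  exact hφ n fun x _ => hf x

end Ext

/-! ### Modules with zero dual -/

section HomTrivial

theorem LinearMap.exists_factor {R A B C : Type*} [CommRing R] [AddCommGroup A] [Module R A]
    [AddCommGroup B] [Module R B] [AddCommGroup C] [Module R C] (p : A →ₗ[R] B)
    (hp : Function.Surjective p) (f : A →ₗ[R] C) (h : ∀ x, p x = 0 → f x = 0) :
    ∃ g : B →ₗ[R] C, ∀ x, g (p x) = f x := by
  have hle : LinearMap.ker p ≤ LinearMap.ker f := fun x hx => h x hx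
  refine ⟨((LinearMap.ker p).liftQ f hle) ∘ₗ (p.quotKerEquivOfSurjective hp).symm, fun x => ?_⟩
  have : (p.quotKerEquivOfSurjective hp).symm (p x) = (LinearMap.ker p).mkQ x := by
    rw [LinearEquiv.symm_apply_eq]; rfl
  rw [LinearMap.comp_apply, LinearEquiv.coe_coe, this, Submodule.mkQ_apply,
    Submodule.liftQ_apply]

/-- `M` has no nonzero functionals. -/
def HomTrivial (R : Type) [CommRing R] (M : Type*) [AddCommGroup M] [Module R M] : Prop :=
  ∀ φ : M →ₗ[R] R, φ = 0

variable {R : Type} [CommRing R] {M M' : Type*} [AddCommGroup M] [Module R M]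
  [AddCommGroup M'] [Module R M']

theorem HomTrivial.of_surjective (h : HomTrivial R M) (f : M →ₗ[R] M')
    (hf : Function.Surjective f) : HomTrivial R M' := fun φ => by
  ext x
  obtain ⟨y, rfl⟩ := hf x
  exact congrArg (fun ψ => ψ y) (h (φ ∘ₗ f))

theorem HomTrivial.subsingleton_of_free (h : HomTrivial R M) [Module.Free R M] :
    Subsingleton M := by
  refine ⟨fun x y => (Module.Free.chooseBasis R M).ext_elem fun i => ?_⟩
  have := h ((Module.Free.chooseBasis R M).coord i)
  rw [← Module.Basis.coord_apply, ← Module.Basis.coord_apply, this]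
  rfl

/-- A functional vanishing on each `C i` vanishes on their sum. -/
theorem homTrivial_iSup {ι : Sort*} (C : ι → Submodule R M) (h : ∀ i, HomTrivial R (C i)) :
    HomTrivial R (⨆ i, C i : Submodule R M) := by
  intro φ
  have hle : ⨆ i, C i ≤ (LinearMap.ker φ).map (⨆ i, C i).subtype := by
    refine iSup_le fun i x hx => ?_
    refine ⟨⟨x, le_iSup C i hx⟩, ?_, rfl⟩
    exact congrArg (fun ψ => ψ (⟨x, hx⟩ : C i))
      (h i (φ ∘ₗ Submodule.inclusion (le_iSup C i)))
  ext ⟨x, hx⟩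
  obtain ⟨y, hy, hyx⟩ := hle hx
  have : (⟨x, hx⟩ : (⨆ i, C i : Submodule R M)) = y := Subtype.ext hyx.symm
  rw [this]
  exact hy

theorem homTrivial_pureClosure [IsDomain R] {C : Submodule R M} (h : HomTrivial R C) :
    HomTrivial R (pureClosure C) := by
  intro φ
  ext ⟨x, r, hr, hx⟩
  have h1 : φ (r • ⟨x, r, hr, hx⟩) = 0 := congrArg (fun ψ => ψ (⟨r • x, hx⟩ : C))
    (h (φ ∘ₗ Submodule.inclusion (le_pureClosure C)))
  rw [map_smul] at h1
  exact (smul_eq_zero.1 h1).resolve_left hr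

end HomTrivial

/-! ### The countable radical and its ℵ₁-free quotient -/

section CountableRadical

variable {R : Type} [CommRing R] [Countable R] {M : Type u} [AddCommGroup M] [Module R M]

theorem exists_homTrivial_iSup {ι : Type*} [Countable ι] (x : ι → M)
    (h : ∀ i, ∃ C : Submodule R M, Countable C ∧ HomTrivial R C ∧ x i ∈ C) :
    ∃ C : Submodule R M, Countable C ∧ HomTrivial R C ∧ ∀ i, x i ∈ C := by
  choose C hC hCt hx using h
  exact ⟨⨆ i, C i, countable_iSup C hC, homTrivial_iSup C hCt, fun i => le_iSup C i (hx i)⟩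

variable (R M) in
/-- The sum of all countable submodules of `M` without nonzero functionals. -/
def countableRadical : Submodule R M where
  carrier := {x | ∃ C : Submodule R M, Countable C ∧ HomTrivial R C ∧ x ∈ C}
  zero_mem' := ⟨⊥, inferInstance, fun φ => by ext x; simp [Subsingleton.elim x 0], rfl⟩
  add_mem' := by
    intro x y hx hy
    obtain ⟨C, hC, hCt, h⟩ := exists_homTrivial_iSup (fun b : Bool => cond b x y)
      (by rintro (_ | _) <;> assumption)
    exact ⟨C, hC, hCt, C.add_mem (h true) (h false)⟩
  smul_mem' := by
    rintro c x ⟨C, hC, hCt, h⟩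
    exact ⟨C, hC, hCt, C.smul_mem c h⟩

variable [IsDomain R] [Module.IsTorsionFree R M]

instance isTorsionFree_quotient_countableRadical :
    Module.IsTorsionFree R (M ⧸ countableRadical R M) := by
  refine IsPureSubmodule.isTorsionFree_quotient (isPureSubmodule_of_forall fun r x hr hx => ?_)
  obtain ⟨C, hC, hCt, h⟩ := hx
  exact ⟨pureClosure C, countable_pureClosure C, homTrivial_pureClosure hCt, r, hr, h⟩

/-- A failure yields a countable minimal non-free `N` in the quotient, with zero dual. Lift it to a
countable `T`; the kernel of `T → N` lies in one countable `D` with zero dual. A functional on `D ⊔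
T` kills `D`, hence factors on `T` through `N` and vanishes. So `T` lies in the radical and `N = 0`,
which is free. -/
theorem isAlephOneFree_quotient_countableRadical [IsPrincipalIdealRing R] :
    IsAlephOneFree R (M ⧸ countableRadical R M) := by
  intro S hS
  have := countable_span (R := R) hS
  by_contra hfree
  obtain ⟨N, -, hNS, hN⟩ := exists_isMinimalNonFree _ hfree
  have hNt : HomTrivial R N := hN.eq_zero
  have := countable_pureClosure (Submodule.span R S)
  have hNc : Countable N := (Submodule.inclusion_injective hNS).countable
  choose t ht using fun n : N => (countableRadical R M).mkQ_surjective n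
  let T := Submodule.span R (Set.range t)
  have hT : Countable T := countable_span (Set.countable_range t)
  have hTN : ∀ x ∈ T, (countableRadical R M).mkQ x ∈ N := by
    have : T ≤ N.comap (countableRadical R M).mkQ := by
      refine Submodule.span_le.2 ?_
      rintro _ ⟨n, rfl⟩
      simp [ht]
    exact this
  let p : T →ₗ[R] N := (countableRadical R M).mkQ.restrict hTN
  have hp : Function.Surjective p := fun n =>
    ⟨⟨t n, Submodule.subset_span ⟨n, rfl⟩⟩, Subtype.ext (ht n)⟩
  have hker : ∀ x : T, p x = 0 → (x : M) ∈ countableRadical R M := fun x hx => by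
    rw [← Submodule.Quotient.mk_eq_zero]
    exact congrArg Subtype.val hx
  obtain ⟨D, hD, hDt, hDx⟩ := exists_homTrivial_iSup (R := R)
    (fun x : LinearMap.ker p => ((x : T) : M)) (fun x => hker x x.2)
  have hDT : HomTrivial R (D ⊔ T : Submodule R M) := by
    intro φ
    have h1 : ∀ x (hx : x ∈ D), φ ⟨x, Submodule.mem_sup_left hx⟩ = 0 := fun x hx =>
      congrArg (fun ψ => ψ (⟨x, hx⟩ : D))
        (hDt (φ ∘ₗ Submodule.inclusion (le_sup_left : D ≤ D ⊔ T)))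
    obtain ⟨ψ, hψ⟩ := LinearMap.exists_factor p hp
      (φ ∘ₗ Submodule.inclusion (le_sup_right : T ≤ D ⊔ T)) (fun x hx => h1 x (hDx ⟨x, hx⟩))
    have h2 : ∀ x (hx : x ∈ T), φ ⟨x, Submodule.mem_sup_right hx⟩ = 0 := fun x hx => by
      have := hψ ⟨x, hx⟩
      rw [hNt ψ] at this
      exact this.symm
    ext ⟨x, hx⟩
    obtain ⟨y, hy, z, hz, rfl⟩ := Submodule.mem_sup.1 hx
    have h3 : (⟨y + z, hx⟩ : (D ⊔ T : Submodule R M)) =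
      ⟨y, Submodule.mem_sup_left hy⟩ + ⟨z, Submodule.mem_sup_right hz⟩ := rfl
    rw [h3, map_add, h1 y hy, h2 z hz]
    simp
  have hN0 : Subsingleton N := by
    refine subsingleton_of_forall_eq 0 fun n => Subtype.ext ?_
    rw [← ht n, Submodule.mkQ_apply, ZeroMemClass.coe_zero, Submodule.Quotient.mk_eq_zero]
    exact ⟨D ⊔ T, countable_sup D T, hDT,
      Submodule.mem_sup_right (Submodule.subset_span ⟨n, rfl⟩)⟩
  exact hN.not_free inferInstance

end CountableRadical

/-! ### Elements divisible by units only -/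

section Unimodular

variable {R : Type} [CommRing R] {M : Type u} [AddCommGroup M] [Module R M]

/-- In a free module an element which is divisible by units only is a value `1` of some
functional. -/
theorem exists_functional_eq_one [IsPrincipalIdealRing R] [Module.Free R M] {e : M}
    (he : ∀ (d : R) (x : M), d • x = e → IsUnit d) : ∃ φ : M →ₗ[R] R, φ e = 1 := by
  -- The values at `e` of all functionals form an ideal `(d)`. Every coordinate of `e` is a multiple
  -- of `d`, so `d` divides `e` and is a unit.
  let ev : (M →ₗ[R] R) →ₗ[R] R := LinearMap.applyₗ e
  obtain ⟨d, hd⟩ := IsPrincipalIdealRing.principal (LinearMap.range ev)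
  have hmem : ∀ φ : M →ₗ[R] R, ∃ c : R, d * c = φ e := fun φ => by
    have : φ e ∈ LinearMap.range ev := ⟨φ, rfl⟩
    rw [hd] at this
    obtain ⟨c, hc⟩ := Submodule.mem_span_singleton.1 this
    exact ⟨c, by rw [mul_comm]; exact hc⟩
  obtain ⟨φ, hφ⟩ : d ∈ LinearMap.range ev := by
    rw [hd]; exact Submodule.mem_span_singleton_self d
  let b := Module.Free.chooseBasis R M
  choose c hc using fun i => hmem (b.coord i)
  have hx : d • ∑ i ∈ (b.repr e).support, c i • b i = e := by
    conv_rhs => rw [← b.linearCombination_repr e, Finsupp.linearCombination_apply, Finsupp.sum]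
    rw [Finset.smul_sum]
    refine Finset.sum_congr rfl fun i _ => ?_
    rw [smul_smul, hc i]
    rfl
  obtain ⟨v, hv⟩ := (he d _ hx).exists_left_inv
  refine ⟨v • φ, ?_⟩
  change v * φ e = 1
  rw [← hv]
  exact congrArg _ hφ

/-- A nontrivial `ℵ₁`-free module has an element which is divisible by units only. -/
theorem IsAlephOneFree.exists_divisible_only_by_units [IsDomain R] [Countable R]
    [Module.IsTorsionFree R M] [Nontrivial M] (h : IsAlephOneFree R M) :
    ∃ e : M, ∀ (d : R) (x : M), d • x = e → IsUnit d := by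
  obtain ⟨z, hz⟩ := exists_ne (0 : M)
  have := countable_span (R := R) (Set.countable_singleton z)
  have := countable_pureClosure (Submodule.span R {z})
  let P := pureClosure (Submodule.span R {z})
  have hP : Module.Free R P := by
    have := h P (Set.to_countable _)
    rwa [Submodule.span_eq] at this
  have hzP : z ∈ P := le_pureClosure _ (Submodule.mem_span_singleton_self z)
  have : Nontrivial P := ⟨⟨z, hzP⟩, 0, fun h0 => hz (congrArg Subtype.val h0)⟩
  -- Any basis element of the pure closure works: its divisors in `M` already lie in `P`, where its
  -- coordinate is `1`.
  let b := Module.Free.chooseBasis R P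
  obtain ⟨i⟩ : Nonempty (Module.Free.ChooseBasisIndex R P) := b.index_nonempty
  refine ⟨b i, fun d x hx => ?_⟩
  have hd : d ≠ 0 := by
    rintro rfl
    rw [zero_smul] at hx
    exact b.ne_zero i (Subtype.ext hx.symm)
  have hxP : x ∈ P := mem_pureClosure_of_smul_mem hd (hx ▸ (b i).2)
  have h1 : d • (⟨x, hxP⟩ : P) = b i := Subtype.ext hx
  have h2 := congrArg (b.coord i) h1
  rw [map_smul, Module.Basis.coord_apply, Module.Basis.coord_apply, b.repr_self,
    Finsupp.single_eq_same] at h2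
  exact IsUnit.of_mul_eq_one _ h2

theorem isTorsionFree_of_isAlephOneFree [IsDomain R] (h : IsAlephOneFree R M) : Module.IsTorsionFree R M := by
  refine Module.isTorsionFree_iff_smul_eq_zero.2 fun r x hx => ?_
  have := h {x} (Set.countable_singleton x)
  have h1 : r • (⟨x, Submodule.mem_span_singleton_self x⟩ : Submodule.span R {x}) = 0 :=
    Subtype.ext hx
  exact (smul_eq_zero.1 h1).imp_right fun h2 => congrArg Subtype.val h2

end Unimodular

/-! ### Transporting the obstruction from `R` to `G / F` -/

section Obstruction

theorem linearMap_fractionRing_eq_self {R : Type} [CommRing R] [IsDomain R]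
    (f : FractionRing R →ₗ[R] FractionRing R) (h : f 1 = 1)
    (x : FractionRing R) : f x = x := by
  obtain ⟨⟨a, b⟩, hab⟩ := IsLocalization.surj (nonZeroDivisors R) x
  have hb : (b : R) ≠ 0 := nonZeroDivisors.ne_zero b.2
  have h1 : (b : R) • x = a • (1 : FractionRing R) := by
    rw [Algebra.smul_def, Algebra.smul_def, mul_one, mul_comm]; exact hab
  have h2 : (b : R) • f x = (b : R) • x := by rw [← map_smul, h1, map_smul, h]
  exact smul_right_injective _ hb h2

variable {R : Type} [CommRing R] [IsDomain R] [IsPrincipalIdealRing R] [Countable R]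
  {G V : Type u} [AddCommGroup G] [Module R G] [Module.IsTorsionFree R G]
  [AddCommGroup V] [Module R V]

/-- If `G / F` is not the union of its countable submodules without nonzero functionals and `N` is
a submodule of `G / F` of finite rank which is not free, then `Ext (N, G / F) ≠ 0`. In terms of a
divisible module `V` containing `G`: some homomorphism `G → V / G` vanishing on `F` has on the
preimage of `N` no lift to `V` which maps `F` into the divisible hull of `F`. -/
theorem exists_obstruction (j : G →ₗ[R] V) (hj : Function.Injective j)
    (hV : ∀ r : R, r ≠ 0 → ∀ x : V, ∃ y : V, r • y = x)
    (F : Submodule R G) (hF : IsPureSubmodule F) [Countable F]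
    (hrad : countableRadical R (G ⧸ F) ≠ ⊤) (N : Submodule R (G ⧸ F)) [Countable N]
    (hNr : Module.rank R N < ℵ₀) (hN : ¬ Module.Free R N) :
    ∃ ψ : G →ₗ[R] V ⧸ LinearMap.range j, (∀ x ∈ F, ψ x = 0) ∧
      ¬ ∃ h : N.comap F.mkQ →ₗ[R] V, (∀ x, (LinearMap.range j).mkQ (h x) = ψ x) ∧
        ∀ x : N.comap F.mkQ, (x : G) ∈ F → ∃ b : R, b ≠ 0 ∧ ∃ y ∈ F, b • h x = j y := by
  have := hF.isTorsionFree_quotient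
  have : Nontrivial ((G ⧸ F) ⧸ countableRadical R (G ⧸ F)) :=
    Submodule.Quotient.nontrivial_iff.2 hrad
  have hL : IsAlephOneFree R ((G ⧸ F) ⧸ countableRadical R (G ⧸ F)) :=
    isAlephOneFree_quotient_countableRadical
  obtain ⟨e', he'⟩ := hL.exists_divisible_only_by_units
  let q : G →ₗ[R] (G ⧸ F) ⧸ countableRadical R (G ⧸ F) :=
    (countableRadical R (G ⧸ F)).mkQ ∘ₗ F.mkQ
  have hqF : ∀ x ∈ F, q x = 0 := fun x hx => by
    have : F.mkQ x = 0 := by rwa [Submodule.mkQ_apply, Submodule.Quotient.mk_eq_zero]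
    rw [LinearMap.comp_apply, this, map_zero]
  obtain ⟨e, rfl⟩ : ∃ e, q e = e' :=
    ((Submodule.mkQ_surjective _).comp (Submodule.mkQ_surjective _)) e'
  have hVB : Module.Baer R V := .of_forall_exists_smul_eq hV
  -- `ε` extends `r ↦ j (r • e)` to the field of fractions; modulo `R` and `j G` it carries the
  -- unliftable `φ` to a map into `V / G`.
  obtain ⟨ε, hε⟩ := hVB.extension_property (Algebra.linearMap R (FractionRing R))
    (IsFractionRing.injective R (FractionRing R)) (LinearMap.toSpanSingleton R V (j e))
  have hε' : ∀ r : R, ε (algebraMap R _ r) = j (r • e) := fun r => by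
    rw [map_smul]; exact congrArg (fun φ => φ r) hε
  have hε1 : ε 1 = j e := by rw [← map_one (algebraMap R (FractionRing R)), hε', one_smul]
  let εbar := (fractionRingOne R).mapQ (LinearMap.range j) ε (by
    rintro _ ⟨r, rfl⟩
    exact ⟨r • e, (hε' r).symm⟩)
  obtain ⟨φ, hφ⟩ := exists_not_liftable hNr hN
  obtain ⟨ψ, hψ⟩ := (baer_quotient hV (LinearMap.range j)).exists_extend N (εbar ∘ₗ φ)
  refine ⟨ψ ∘ₗ F.mkQ, fun x hx => ?_, ?_⟩
  · have : F.mkQ x = 0 := by rwa [Submodule.mkQ_apply, Submodule.Quotient.mk_eq_zero]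
    rw [LinearMap.comp_apply, this, map_zero]
  rintro ⟨h, hlift, hhF⟩
  let p := F.mkQ.submoduleComap N
  have hp : Function.Surjective p := F.mkQ.submoduleComap_surjective_of_surjective N
    F.mkQ_surjective
  have hpF : ∀ x : N.comap F.mkQ, p x = 0 → (x : G) ∈ F := fun x hx => by
    rw [← Submodule.Quotient.mk_eq_zero]
    exact congrArg Subtype.val hx
  have hcount : Countable (N.comap F.mkQ) := countable_comap_mkQ F N
  choose c hc using fun n : N.comap F.mkQ => (fractionRingOne R).mkQ_surjective (φ (p n))
  have hg : ∀ n, ∃ g : G, j g = h n - ε (c n) := by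
    intro n
    have h1 : (LinearMap.range j).mkQ (h n) = (LinearMap.range j).mkQ (ε (c n)) := by
      rw [hlift n, LinearMap.comp_apply]
      have h2 := hψ (p n)
      rw [LinearMap.comp_apply, ← hc n] at h2
      exact h2
    have h3 : (LinearMap.range j).mkQ (h n - ε (c n)) = 0 := by rw [map_sub, h1, sub_self]
    rwa [Submodule.mkQ_apply, Submodule.Quotient.mk_eq_zero] at h3
  choose g hg using hg
  -- A lift `h` differs from `ε ∘ c` only by countably many elements `g n` of `G`. Their images and
  -- that of `e` span a free module, so some functional is integral on all of them and equals `1` at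
  -- `e`.
  let S : Set ((G ⧸ F) ⧸ countableRadical R (G ⧸ F)) :=
    insert (q e) (Set.range fun n => q (g n))
  have hS : Module.Free R (Submodule.span R S) := hL S ((Set.countable_range _).insert _)
  have heS : q e ∈ Submodule.span R S := Submodule.subset_span (Set.mem_insert _ _)
  obtain ⟨l, hl⟩ := exists_functional_eq_one (e := (⟨q e, heS⟩ : Submodule.span R S))
    fun d x hx => he' d x (congrArg Subtype.val hx)
  obtain ⟨Λ', hΛ'⟩ := baer_fractionRing.exists_extend (Submodule.span R S)
    ((Algebra.linearMap R (FractionRing R)) ∘ₗ l)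
  obtain ⟨Λ, hΛ⟩ := (baer_fractionRing (R := R)).extension_property j hj (Λ' ∘ₗ q)
  have hΛj : ∀ x, Λ (j x) = Λ' (q x) := fun x => congrArg (fun f => f x) hΛ
  have hΛε : ∀ x, Λ (ε x) = x := fun x => by
    refine linearMap_fractionRing_eq_self (Λ ∘ₗ ε) ?_ x
    have h1 : Λ' (q e) = algebraMap R (FractionRing R) (l ⟨q e, heS⟩) := hΛ' ⟨q e, heS⟩
    rw [LinearMap.comp_apply, hε1, hΛj, h1, hl, map_one]
  -- This is where the hull condition enters: `Λ` kills the hull of `F`, so `Λ ∘ h` descends to `N`,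
  -- where it is a lift of `φ`.
  have hΛF : ∀ x, p x = 0 → (Λ ∘ₗ h) x = 0 := fun x hx => by
    obtain ⟨b, hb, y, hy, hxy⟩ := hhF x (hpF x hx)
    have h1 : b • Λ (h x) = 0 := by rw [← map_smul, hxy, hΛj, hqF y hy, map_zero]
    exact (smul_eq_zero.1 h1).resolve_left hb
  obtain ⟨f, hf⟩ := LinearMap.exists_factor p hp (Λ ∘ₗ h) hΛF
  refine hφ ⟨f, fun n => ?_⟩
  obtain ⟨n, rfl⟩ := hp n
  have hgS : q (g n) ∈ Submodule.span R S :=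
    Submodule.subset_span (Set.mem_insert_of_mem _ ⟨n, rfl⟩)
  have h1 : Λ (h n) = Λ' (q (g n)) + c n := by
    rw [← hΛj, hg, map_sub, hΛε, sub_add_cancel]
  have h2 : Λ' (q (g n)) ∈ fractionRingOne R := ⟨l ⟨q (g n), hgS⟩, (hΛ' ⟨q (g n), hgS⟩).symm⟩
  rw [hf n, LinearMap.comp_apply, h1, map_add, hc n, add_eq_right, Submodule.mkQ_apply,
    Submodule.Quotient.mk_eq_zero]
  exact h2

end Obstruction

/-! ### Splitters and lifting along `V → V / G` -/

section Splitter

variable {R : Type} [CommRing R] {G V : Type u} [AddCommGroup G] [Module R G]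
  [AddCommGroup V] [Module R V]

/-- The pullback of `V → V / G` along `f` is an extension of `G` by `G`; the `V`-component of a
splitting is the lift. -/
theorem IsSplitter.exists_lift (hG : IsSplitter R G) (j : G →ₗ[R] V) (hj : Function.Injective j)
    (f : G →ₗ[R] V ⧸ LinearMap.range j) :
    ∃ h : G →ₗ[R] V, ∀ x, (LinearMap.range j).mkQ (h x) = f x := by
  let X : Submodule R (V × G) := LinearMap.eqLocus
    ((LinearMap.range j).mkQ ∘ₗ LinearMap.fst R V G) (f ∘ₗ LinearMap.snd R V G)
  have hX : ∀ x : V × G, x ∈ X ↔ (LinearMap.range j).mkQ x.1 = f x.2 := fun _ => Iff.rfl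
  let β : G →ₗ[R] X := (LinearMap.inl R V G ∘ₗ j).codRestrict X fun x => by
    rw [hX, LinearMap.comp_apply, LinearMap.inl_apply, map_zero, Submodule.mkQ_apply,
      Submodule.Quotient.mk_eq_zero]
    exact ⟨x, rfl⟩
  let α : X →ₗ[R] G := LinearMap.snd R V G ∘ₗ X.subtype
  have hβ : Function.Injective β := fun x y hxy =>
    hj (congrArg (fun z : X => (z : V × G).1) hxy)
  have hβα : Function.Exact β α := by
    rintro ⟨⟨v, g⟩, hx⟩
    constructor
    · intro hg
      obtain rfl : g = 0 := hg
      rw [hX, map_zero, Submodule.mkQ_apply, Submodule.Quotient.mk_eq_zero] at hx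
      obtain ⟨y, rfl⟩ := hx
      exact ⟨y, rfl⟩
    · rintro ⟨y, hy⟩
      exact (congrArg (fun z : X => (z : V × G).2) hy).symm
  have hα : Function.Surjective α := fun g => by
    obtain ⟨v, hv⟩ := (LinearMap.range j).mkQ_surjective (f g)
    exact ⟨⟨(v, g), hv⟩, rfl⟩
  obtain ⟨γ, hγ⟩ := hG X β α hβ hβα hα
  refine ⟨LinearMap.fst R V G ∘ₗ X.subtype ∘ₗ γ, fun x => ?_⟩
  have h1 := (hX _).1 (γ x).2
  have h2 : (γ x : V × G).2 = x := congrArg (fun φ => φ x) hγ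
  rw [h2] at h1
  exact h1

/-- Every torsion-free module over a domain has a divisible hull. -/
theorem exists_divisible_hull [IsDomain R] [Module.IsTorsionFree R G] :
    ∃ (V : Type u) (_ : AddCommGroup V) (_ : Module R V) (j : G →ₗ[R] V), Function.Injective j ∧
      (∀ r : R, r ≠ 0 → ∀ x : V, ∃ y : V, r • y = x) ∧
      ∀ x : V, ∃ b : R, b ≠ 0 ∧ ∃ y, b • x = j y := by
  let j := LocalizedModule.mkLinearMap (nonZeroDivisors R) G
  refine ⟨LocalizedModule (nonZeroDivisors R) G, inferInstance, inferInstance, j, ?_, ?_, ?_⟩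
  · rw [← LinearMap.ker_eq_bot, eq_bot_iff]
    intro x hx
    obtain ⟨r, hr, hrx⟩ := LocalizedModule.mem_ker_mkLinearMap_iff.1 hx
    exact (smul_eq_zero.1 hrx).resolve_left (nonZeroDivisors.ne_zero hr)
  · intro r hr x
    have hu := IsLocalizedModule.map_units j ⟨r, mem_nonZeroDivisors_of_ne_zero hr⟩
    exact ((Module.End.isUnit_iff _).1 hu).surjective x
  · intro x
    obtain ⟨⟨y, b⟩, hy⟩ := IsLocalizedModule.surj (nonZeroDivisors R) j x
    exact ⟨b, nonZeroDivisors.ne_zero b.2, y, hy⟩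

end Splitter

/-! ### Countable ordinals -/

section Ordinals

theorem countable_Iio_of_lt_omega_one {α : Ordinal.{0}} (hα : α < ω₁) : Countable (Set.Iio α) := by
  rw [← Cardinal.mk_le_aleph0_iff, Cardinal.mk_Iio_ordinal, Cardinal.lift_le_aleph0,
    ← Cardinal.lt_aleph_one_iff, ← Cardinal.lt_ord, Cardinal.ord_aleph]
  exact hα

theorem exists_ordinal_enumeration {G : Type u} (hG : #G = ℵ₁) :
    ∃ x : Ordinal.{0} → G, ∀ g, ∃ β < ω₁, x β = g := by
  have h : Cardinal.lift.{1} #G = Cardinal.lift.{u} #(Set.Iio (ω₁ : Ordinal.{0})) := by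
    rw [hG, Cardinal.mk_Iio_ordinal, Ordinal.card_omega]
    simp
  obtain ⟨e⟩ := Cardinal.lift_mk_eq'.1 h
  have : Nonempty G := by
    rw [← Cardinal.mk_ne_zero_iff, hG]
    exact (Cardinal.aleph_pos 1).ne'
  classical
  refine ⟨fun β => if hβ : β < ω₁ then e.symm ⟨β, hβ⟩ else Classical.arbitrary G, fun g => ?_⟩
  refine ⟨e g, (e g).2, ?_⟩
  have hg : ((e g : Set.Iio (ω₁ : Ordinal.{0})) : Ordinal) < ω₁ := (e g).2
  simp only [hg, dif_pos]
  exact e.symm_apply_apply g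

end Ordinals

/-! ### Building filtrations step by step -/

section Filtration

variable {R : Type} [CommRing R] {G : Type u} [AddCommGroup G] [Module R G]

/-- The chain of submodules obtained by iterating `step` transfinitely. -/
noncomputable def stepChain (step : Ordinal.{0} → Submodule R G → Submodule R G) (α : Ordinal.{0}) :
    Submodule R G :=
  ⨆ β : Set.Iio α, step β.1 (stepChain step β.1)
termination_by α
decreasing_by exact β.2

theorem IsAlephOneFiltration.exists_le {F : Ordinal.{0} → Submodule R G}
    (hF : IsAlephOneFiltration F) {S : Set G} (hS : S.Countable) :
    ∃ α < ω₁, S ⊆ F α := by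
  choose a ha hx using hF.exhaustive
  have := hS.to_subtype
  have hlt : ⨆ x : S, a x < ω₁ := Ordinal.iSup_lt_omega_one fun x => ha x
  refine ⟨_, hlt, fun x hxS => hF.mono _ _ ?_ hlt (hx x)⟩
  exact Ordinal.le_iSup (fun x : S => a x) ⟨x, hxS⟩

variable (step : Ordinal.{0} → Submodule R G → Submodule R G)

theorem step_le_stepChain {β α : Ordinal.{0}} (h : β < α) :
    step β (stepChain step β) ≤ stepChain step α := by
  rw [stepChain.eq_def step α]
  exact le_iSup (fun β : Set.Iio α => step β.1 (stepChain step β.1)) ⟨β, h⟩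

theorem stepChain_mono : Monotone (stepChain step) := by
  intro α β h
  rw [stepChain.eq_def step α]
  exact iSup_le fun γ => step_le_stepChain step (γ.2.trans_le h)

variable {step}

theorem stepChain_succ (hstep : ∀ β K, K ≤ step β K) (α : Ordinal.{0}) :
    stepChain step (Order.succ α) = step α (stepChain step α) := by
  refine le_antisymm ?_ (step_le_stepChain step (Order.lt_succ α))
  rw [stepChain.eq_def step (Order.succ α)]
  refine iSup_le fun ⟨γ, hγ⟩ => ?_
  rcases (Order.lt_succ_iff.1 (show γ < Order.succ α from hγ)).lt_or_eq with h | rfl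
  · exact (step_le_stepChain step h).trans (hstep _ _)
  · exact le_rfl

theorem directed_stepChain (hstep : ∀ β K, K ≤ step β K) (α : Ordinal.{0}) :
    Directed (· ≤ ·) fun β : Set.Iio α => step β.1 (stepChain step β.1) := by
  have hmono : Monotone fun β : Set.Iio α => step β.1 (stepChain step β.1) := by
    rintro ⟨β, hβ⟩ ⟨γ, hγ⟩ h
    rcases (show β ≤ γ from h).lt_or_eq with h | rfl
    · exact (step_le_stepChain step h).trans (hstep _ _)
    · exact le_rfl
  exact hmono.directed_le

theorem mem_stepChain (hstep : ∀ β K, K ≤ step β K) {α : Ordinal.{0}} (hα : α ≠ 0) {x : G} :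
    x ∈ stepChain step α ↔ ∃ β < α, x ∈ step β (stepChain step β) := by
  have : Nonempty (Set.Iio α) := ⟨⟨0, pos_iff_ne_zero.2 hα⟩⟩
  rw [stepChain.eq_def step α, Submodule.mem_iSup_of_directed _ (directed_stepChain hstep α)]
  simp

theorem stepChain_zero : stepChain step 0 = ⊥ := by
  rw [stepChain.eq_def step 0, eq_bot_iff]
  exact iSup_le fun ⟨γ, hγ⟩ => absurd hγ (not_lt_bot (a := γ))

variable [IsDomain R] [Countable R]

/-- Filtrations of `ℵ₁`-free modules are built step by step. -/
theorem IsAlephOneFree.exists_filtration (hG : IsAlephOneFree R G)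
    (Spec : Ordinal.{0} → Submodule R G → Submodule R G → Prop)
    (h : ∀ β < ω₁, ∀ K : Submodule R G, Countable K → IsPureSubmodule K →
      ∃ K', K ≤ K' ∧ Countable K' ∧ IsPureSubmodule K' ∧ Spec β K K') :
    ∃ F : Ordinal.{0} → Submodule R G, Monotone F ∧ (∀ α < ω₁, Countable (F α)) ∧
      (∀ α, α ≠ 0 → ∀ x ∈ F α, ∃ β < α, x ∈ F (Order.succ β)) ∧
      ((∀ x, ∃ α < ω₁, x ∈ F α) → IsAlephOneFiltration F) ∧
      ∀ β < ω₁, Spec β (F β) (F (Order.succ β)) := by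
  classical
  have := isTorsionFree_of_isAlephOneFree hG
  -- Where the hypotheses on `β` and `K` fail, the step keeps `K`; thus it is total and always
  -- increasing.
  have h' : ∀ β (K : Submodule R G), ∃ K' : Submodule R G, K ≤ K' ∧ (β < ω₁ → Countable K → IsPureSubmodule K →
      Countable K' ∧ IsPureSubmodule K' ∧ Spec β K K') := by
    intro β K
    by_cases hK : β < ω₁ ∧ Countable K ∧ IsPureSubmodule K
    · obtain ⟨K', h1, h2⟩ := h β hK.1 K hK.2.1 hK.2.2
      exact ⟨K', h1, fun _ _ _ => h2⟩
    · exact ⟨K, le_rfl, fun h1 h2 h3 => absurd ⟨h1, h2, h3⟩ hK⟩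
  choose step hstep hspec using h'
  have hgood : ∀ α < ω₁, Countable (stepChain step α) ∧ IsPureSubmodule (stepChain step α) := by
    intro α
    induction α using WellFoundedLT.induction with
    | ind α ih =>
      intro hα
      have hIio := countable_Iio_of_lt_omega_one hα
      have ih' : ∀ β : Set.Iio α, Countable (step β.1 (stepChain step β.1)) ∧
          IsPureSubmodule (step β.1 (stepChain step β.1)) := fun β => by
        have hβ := β.2.trans hα
        obtain ⟨h1, h2⟩ := ih β.1 β.2 hβ
        obtain ⟨h3, h4, -⟩ := hspec β.1 _ hβ h1 h2
        exact ⟨h3, h4⟩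
      refine ⟨?_, isPureSubmodule_of_forall fun r x hr hx => ?_⟩
      · rw [stepChain.eq_def step α]
        exact countable_iSup _ fun β => (ih' β).1
      · rcases eq_or_ne α 0 with rfl | h0
        · rw [stepChain_zero, Submodule.mem_bot] at hx ⊢
          exact (smul_eq_zero.1 hx).resolve_left hr
        · obtain ⟨β, hβ, hx⟩ := (mem_stepChain hstep h0).1 hx
          exact (mem_stepChain hstep h0).2 ⟨β, hβ, (ih' ⟨β, hβ⟩).2.mem_of_smul_mem hr hx⟩
  refine ⟨stepChain step, stepChain_mono step, fun α hα => (hgood α hα).1,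
    fun α hα x hx => ?_, fun hex => ?_, fun β hβ => ?_⟩
  · obtain ⟨β, hβ, hx⟩ := (mem_stepChain hstep hα).1 hx
    exact ⟨β, hβ, step_le_stepChain step (Order.lt_succ β) hx⟩
  · refine ⟨stepChain_zero, fun α β h _ => stepChain_mono step h, fun δ _ hδ x => ?_, hex,
      fun α hα => (hgood α hα).1, fun α hα => ?_, fun α hα => (hgood α hα).2⟩
    · refine ⟨fun hx => ?_, fun ⟨α, hα, hx⟩ => stepChain_mono step hα.le hx⟩
      obtain ⟨β, hβ, hx⟩ := (mem_stepChain hstep hδ.ne_bot).1 hx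
      exact ⟨Order.succ β, hδ.succ_lt hβ, step_le_stepChain step (Order.lt_succ β) hx⟩
    · have := (hgood α hα).1
      have h1 := hG (stepChain step α) (Set.to_countable _)
      rwa [Submodule.span_eq] at h1
  · rw [stepChain_succ hstep]
    obtain ⟨h1, h2⟩ := hgood β hβ
    exact (hspec β _ hβ h1 h2).2.2

end Filtration

/-! ### Criteria for type II and type I -/

section Types

variable {R : Type} [CommRing R] [IsDomain R] [Countable R] {G : Type u} [AddCommGroup G] [Module R G]

/-- A module is of type II as soon as its countable submodules lie in countable submodules with
`ℵ₁`-free quotient. -/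
theorem isTypeII_of_forall (hG : IsAlephOneFree R G) (hcard : #G = ℵ₁)
    (h : ∀ C : Submodule R G, Countable C →
      ∃ H : Submodule R G, C ≤ H ∧ Countable H ∧ IsAlephOneFree R (G ⧸ H)) :
    IsTypeII R G := by
  obtain ⟨x, hx⟩ := exists_ordinal_enumeration hcard
  obtain ⟨F, -, -, -, hF, hspec⟩ := hG.exists_filtration
    (fun β _ K' => x β ∈ K' ∧ IsAlephOneFree R (G ⧸ K')) (fun β _ K hK _ => by
      have := countable_span (R := R) (Set.countable_singleton (x β))
      obtain ⟨H, hCH, hH, hHfree⟩ := h (K ⊔ Submodule.span R {x β}) (countable_sup _ _)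
      have := isTorsionFree_of_isAlephOneFree hHfree
      exact ⟨H, le_sup_left.trans hCH, hH, isPureSubmodule_of_isTorsionFree_quotient,
        hCH (Submodule.mem_sup_right (Submodule.mem_span_singleton_self _)), hHfree⟩)
  have hF := hF fun g => by
    obtain ⟨β, hβ, rfl⟩ := hx g
    exact ⟨Order.succ β, (Cardinal.isSuccLimit_omega 1).succ_lt hβ, (hspec β hβ).1⟩
  refine ⟨F, hF, fun α hα hlim => ?_⟩
  rw [Order.not_isSuccLimit_iff] at hlim
  rcases hlim with hmin | hsucc
  · have h0 : F α = ⊥ := by rw [hmin.eq_bot]; exact hF.zero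
    rw [h0]
    intro S hS
    have e := (Submodule.quotEquivOfEqBot (⊥ : Submodule R G) rfl).submoduleMap
      (Submodule.span R S)
    rw [Submodule.map_span] at e
    have := hG _ (hS.image (Submodule.quotEquivOfEqBot (⊥ : Submodule R G) rfl))
    exact Module.Free.of_equiv e.symm
  · obtain ⟨β, rfl⟩ := Order.mem_range_succ_of_not_isSuccPrelimit hsucc
    exact (hspec β ((Order.lt_succ β).trans hα)).2

/-- A module `G` of cardinality `ℵ₁` is of type I as soon as for some countable submodule `H` the
quotient `G / H` is the union of its countable submodules without nonzero functionals. -/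
theorem isTypeI_of_countableRadical_eq_top [IsPrincipalIdealRing R] (hG : IsAlephOneFree R G)
    (hcard : #G = ℵ₁) (H : Submodule R G) [Countable H] (hrad : countableRadical R (G ⧸ H) = ⊤) :
    IsTypeI R G := by
  have := isTorsionFree_of_isAlephOneFree hG
  obtain ⟨x, hx⟩ := exists_ordinal_enumeration hcard
  have hC : ∀ β, ∃ C : Submodule R G, Countable C ∧ x β ∈ C ∧
      ∀ K : Submodule R G, H ≤ K → HomTrivial R (C.map K.mkQ) := by
    intro β
    have hβ : H.mkQ (x β) ∈ countableRadical R (G ⧸ H) := hrad ▸ Submodule.mem_top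
    obtain ⟨D, hD, hDt, hxD⟩ := hβ
    choose t ht using fun d : D => H.mkQ_surjective d
    let C := Submodule.span R (insert (x β) (Set.range t))
    have hCD : C.map H.mkQ = D := by
      refine le_antisymm ?_ fun d hd => ?_
      · rw [Submodule.map_le_iff_le_comap]
        refine Submodule.span_le.2 ?_
        rintro _ (rfl | ⟨d, rfl⟩)
        · exact hxD
        · simp [ht]
      · exact ⟨t ⟨d, hd⟩, Submodule.subset_span (Set.mem_insert_of_mem _ ⟨⟨d, hd⟩, rfl⟩), ht _⟩
    refine ⟨C, countable_span ((Set.countable_range t).insert _),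
      Submodule.subset_span (Set.mem_insert _ _), fun K hK => ?_⟩
    rw [← hCD] at hDt
    have hfac : K.mkQ = H.mapQ K LinearMap.id hK ∘ₗ H.mkQ := by ext; rfl
    rw [hfac, Submodule.map_comp]
    exact hDt.of_surjective _
      ((H.mapQ K LinearMap.id hK).submoduleMap_surjective (C.map H.mkQ))
  choose C hCc hxC hCt using hC
  -- Stage `0` absorbs `H`. A later stage adjoins a minimal non-free piece inside the pure closure
  -- of `C i ⊔ K`, with `i` least such that `C i` is not yet contained in `K`; the last clause
  -- records this choice, which forces exhaustion.
  obtain ⟨F, hmono, hFc, hunion, hF, hspec⟩ := hG.exists_filtration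
    (fun β K K' => (β = 0 → H ≤ K') ∧ (β ≠ 0 → H ≤ K → IsMinimalNonFree R (K'.map K.mkQ) ∧
      ∀ i, (∀ k < i, C k ≤ K) → ¬ C i ≤ K → K' ≤ pureClosure (C i ⊔ K))) (by
    intro β _ K hK hKp
    by_cases hβ : β = 0
    · have := countable_sup K H
      exact ⟨pureClosure (K ⊔ H), le_sup_left.trans (le_pureClosure _), countable_pureClosure _,
        isPureSubmodule_pureClosure _, fun _ => le_sup_right.trans (le_pureClosure _),
        fun h => absurd hβ h⟩
    by_cases hHK : H ≤ K
    swap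
    · exact ⟨K, le_rfl, hK, hKp, fun h => absurd h hβ, fun _ h => absurd h hHK⟩
    have hKQ := hKp.isTorsionFree_quotient
    have hne : {i | ¬ C i ≤ K}.Nonempty := by
      by_contra hne
      have hall : ∀ g, g ∈ K := fun g => by
        obtain ⟨i, -, rfl⟩ := hx g
        by_contra hi
        exact hne ⟨i, fun h => hi (h (hxC i))⟩
      have : Countable G := (Function.Injective.countable (f := fun g : G => (⟨g, hall g⟩ : K))
        fun a b hab => congrArg Subtype.val hab)
      have h1 := Cardinal.mk_le_aleph0_iff.2 this
      rw [hcard, ← Cardinal.lt_aleph_one_iff] at h1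
      exact lt_irrefl _ h1
    obtain ⟨i, hi, hmin⟩ := (wellFounded_lt (α := Ordinal.{0})).has_min _ hne
    have hCi := hCc i
    have hcQ : Countable ((C i).map K.mkQ) :=
      (K.mkQ.submoduleMap_surjective (C i)).countable
    -- A free module with zero dual is zero, whereas the image of `C i` is not.
    have hnf : ¬ Module.Free R ((C i).map K.mkQ) := fun hf => by
      have := (hCt i K hHK).subsingleton_of_free
      refine hi fun y hy => ?_
      have h1 := congrArg Subtype.val
        (Subsingleton.elim (⟨K.mkQ y, y, hy, rfl⟩ : (C i).map K.mkQ) 0)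
      exact (Submodule.Quotient.mk_eq_zero K).1 h1
    obtain ⟨N, hNp, hNC, hN⟩ := exists_isMinimalNonFree _ hnf
    have hle : N.comap K.mkQ ≤ pureClosure (C i ⊔ K) := by
      intro y hy
      obtain ⟨r, hr, z, hz, hzy⟩ := hNC hy
      refine ⟨r, hr, ?_⟩
      have h1 : r • y - z ∈ K := by
        rw [← Submodule.Quotient.mk_eq_zero, ← Submodule.mkQ_apply, map_sub, map_smul, hzy,
          sub_self]
      have h2 := Submodule.add_mem_sup hz h1
      rwa [add_sub_cancel] at h2
    refine ⟨N.comap K.mkQ, Submodule.le_comap_mkQ K N, ?_, hNp.comap K.mkQ,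
      fun h => absurd h hβ, fun _ _ => ⟨?_, fun k hk hCk => ?_⟩⟩
    · have := countable_sup (C i) K
      have := countable_pureClosure (C i ⊔ K)
      exact (Submodule.inclusion_injective hle).countable
    · rwa [Submodule.map_comap_eq_of_surjective K.mkQ_surjective]
    · obtain rfl : k = i := by
        rcases lt_trichotomy k i with h | h | h
        · exact absurd h (hmin k hCk)
        · exact h
        · exact absurd (hk i h) hi
      exact hle)
  have hH : ∀ α, α ≠ 0 → H ≤ F α := fun α hα =>
    ((hspec 0 (Ordinal.omega_pos 1)).1 rfl).trans
      (hmono (Order.succ_le_of_lt (pos_iff_ne_zero.2 hα)))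
  refine ⟨F, hF ?_, fun α hα hα1 => ((hspec α hα1).2 hα.ne' (hH α hα.ne')).1⟩
  have hex : ∀ i < ω₁, ∃ α < ω₁, C i ≤ F α := by
    by_contra hex
    obtain ⟨i, ⟨hi, hCi⟩, hmin⟩ := (wellFounded_lt (α := Ordinal.{0})).has_min
      {i | i < ω₁ ∧ ¬ ∃ α < ω₁, C i ≤ F α} (by
        push Not at hex
        obtain ⟨i, hi, hCi⟩ := hex
        exact ⟨i, hi, fun ⟨α, hα, h⟩ => hCi α hα h⟩)
    have hlow : ∀ k : Set.Iio i, ∃ α < ω₁, C k ≤ F α := fun k => by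
      by_contra hk
      exact hmin k ⟨k.2.trans hi, hk⟩ k.2
    choose a ha hCa using hlow
    have := countable_Iio_of_lt_omega_one hi
    have hsup : ⨆ k, a k < ω₁ := Ordinal.iSup_lt_omega_one ha
    let α₀ := max 1 (⨆ k, a k)
    have hα₀ : α₀ < ω₁ := max_lt (Ordinal.one_lt_omega0.trans Ordinal.omega0_lt_omega_one) hsup
    have hpos : ∀ α, α₀ ≤ α → α ≠ 0 := fun α h =>
      (zero_lt_one.trans_le ((le_max_left _ _).trans h)).ne'
    have hstep : ∀ α, α₀ ≤ α → α < ω₁ → IsMinimalNonFree R ((F (Order.succ α)).map (F α).mkQ) ∧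
        F (Order.succ α) ≤ pureClosure (C i ⊔ F α) := fun α h h1 => by
      obtain ⟨h2, h3⟩ := (hspec α h1).2 (hpos α h) (hH α (hpos α h))
      refine ⟨h2, h3 i (fun k hk => (hCa ⟨k, hk⟩).trans (hmono ?_)) fun h4 => hCi ⟨α, h1, h4⟩⟩
      exact (Ordinal.le_iSup a ⟨k, hk⟩).trans ((le_max_right _ _).trans h)
    -- If `C i` is the first never to be covered, all stages from `α₀` on stay in the countable `Z`.
    -- Each adds a new element, giving an injection of an uncountable interval of ordinals into `Z`.
    let Z := pureClosure (C i ⊔ F α₀)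
    have hZ : ∀ α, α < ω₁ → F α ≤ Z := by
      intro α
      induction α using WellFoundedLT.induction with
      | ind α ih =>
        intro hα
        rcases le_total α α₀ with h | h
        · exact (hmono h).trans (le_sup_right.trans (le_pureClosure _))
        · intro y hy
          obtain ⟨β, hβ, hy⟩ := hunion α (hpos α h) y hy
          rcases lt_or_ge β α₀ with h1 | h1
          · exact le_pureClosure _ (Submodule.mem_sup_right (hmono (Order.succ_le_of_lt h1) hy))
          · have hβ1 := hβ.trans hα
            refine (isPureSubmodule_pureClosure _).pureClosure_le (sup_le ?_ (ih β hβ hβ1))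
              ((hstep β h1 hβ1).2 hy)
            exact le_sup_left.trans (le_pureClosure _)
    have hnew : ∀ α : Set.Ico α₀ ω₁, ∃ z ∈ F (Order.succ α.1), z ∉ F α := by
      rintro ⟨α, h, h1⟩
      by_contra! hall
      refine (hstep α h h1).1.not_free ?_
      have hbot : (F (Order.succ α)).map (F α).mkQ = ⊥ := by
        rw [← le_bot_iff, Submodule.map_le_iff_le_comap]
        intro z hz
        exact (Submodule.Quotient.mk_eq_zero _).2 (hall z hz)
      rw [hbot]
      infer_instance
    choose z hz hzn using hnew
    have hcount : Countable (Set.Ico α₀ ω₁) := by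
      have := hCc i
      have := hFc α₀ hα₀
      have := countable_sup (C i) (F α₀)
      have : Countable Z := countable_pureClosure _
      have hsucc : ∀ α : Set.Ico α₀ ω₁, Order.succ α.1 < ω₁ := fun α =>
        (Cardinal.isSuccLimit_omega 1).succ_lt α.2.2
      have hlt : ∀ α β : Set.Ico α₀ ω₁, α.1 < β.1 → z α ≠ z β := fun α β h heq =>
        hzn β (heq ▸ hmono (Order.succ_le_of_lt h) (hz α))
      refine Function.Injective.countable
        (f := fun α => (⟨z α, hZ _ (hsucc α) (hz α)⟩ : Z)) fun α β h => ?_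
      have heq : z α = z β := congrArg Subtype.val h
      rcases lt_trichotomy α.1 β.1 with h1 | h1 | h1
      · exact absurd heq (hlt α β h1)
      · exact Subtype.ext h1
      · exact absurd heq.symm (hlt β α h1)
    have hγ : ⨆ α : Set.Ico α₀ ω₁, Order.succ α.1 < ω₁ :=
      Ordinal.iSup_lt_omega_one fun α => (Cardinal.isSuccLimit_omega 1).succ_lt α.2.2
    let δ : Set.Ico α₀ ω₁ := ⟨max α₀ (⨆ α : Set.Ico α₀ ω₁, Order.succ α.1), le_max_left _ _,
      max_lt hα₀ hγ⟩
    have h1 : Order.succ δ.1 ≤ δ.1 :=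
      (Ordinal.le_iSup (fun α : Set.Ico α₀ ω₁ => Order.succ α.1) δ).trans (le_max_right _ _)
    exact (Order.lt_succ δ.1).not_ge h1
  intro g
  obtain ⟨i, hi, rfl⟩ := hx g
  obtain ⟨α, hα, h⟩ := hex i hi
  exact ⟨α, hα, h (hxC i)⟩

end Types

/-! ### Splitters are of type I or type II -/

section Main

variable {R : Type} [CommRing R] [IsDomain R] [IsPrincipalIdealRing R] [Countable R]
  {G : Type u} [AddCommGroup G] [Module R G]

/-- If `G` is a splitter with `G / H` not `ℵ₁`-free for all large countable `H`, then for some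
countable `H` the module `G / H` is the union of its countable submodules without nonzero
functionals. -/
theorem IsSplitter.exists_countableRadical_eq_top (hs : IsSplitter R G) (hG : IsAlephOneFree R G)
    (hcard : #G = ℵ₁) (C : Submodule R G) [Countable C]
    (hC : ∀ H : Submodule R G, C ≤ H → Countable H → ¬ IsAlephOneFree R (G ⧸ H)) :
    ∃ H : Submodule R G, Countable H ∧ countableRadical R (G ⧸ H) = ⊤ := by
  by_contra! hrad
  have := isTorsionFree_of_isAlephOneFree hG
  obtain ⟨x, hx⟩ := exists_ordinal_enumeration hcard
  obtain ⟨F, hmono, hFc, hunion, hF, hspec⟩ := hG.exists_filtration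
    (fun β K K' => x β ∈ K' ∧ (¬ IsAlephOneFree R (G ⧸ K) → ∃ N : Submodule R (G ⧸ K),
      Countable N ∧ Module.rank R N < ℵ₀ ∧ ¬ Module.Free R N ∧ N.comap K.mkQ ≤ K')) (by
    intro β _ K hK hKp
    have := hKp.isTorsionFree_quotient
    have hex : ∃ L : Submodule R G, Countable L ∧ (¬ IsAlephOneFree R (G ⧸ K) →
        ∃ N : Submodule R (G ⧸ K), Countable N ∧ Module.rank R N < ℵ₀ ∧ ¬ Module.Free R N ∧
          N.comap K.mkQ ≤ L) := by
      by_cases hfree : IsAlephOneFree R (G ⧸ K)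
      · exact ⟨⊥, inferInstance, fun h => absurd hfree h⟩
      · unfold IsAlephOneFree at hfree
        push Not at hfree
        obtain ⟨S, hS, hSf⟩ := hfree
        have := countable_span (R := R) hS
        obtain ⟨N, -, hNS, hN⟩ := exists_isMinimalNonFree _ hSf
        have := countable_pureClosure (Submodule.span R S)
        have hNc : Countable N := (Submodule.inclusion_injective hNS).countable
        exact ⟨N.comap K.mkQ, countable_comap_mkQ K N,
          fun _ => ⟨N, hNc, hN.finiteRank, hN.not_free, le_rfl⟩⟩
    obtain ⟨L, hL, hN⟩ := hex
    have := countable_span (R := R) (Set.countable_singleton (x β))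
    have := countable_sup K L
    have := countable_sup (K ⊔ L) (Submodule.span R {x β})
    refine ⟨pureClosure (K ⊔ L ⊔ Submodule.span R {x β}),
      le_sup_left.trans (le_sup_left.trans (le_pureClosure _)), countable_pureClosure _,
      isPureSubmodule_pureClosure _, le_pureClosure _ (Submodule.mem_sup_right
        (Submodule.mem_span_singleton_self _)), fun h => ?_⟩
    obtain ⟨N, h1, h2, h3, h4⟩ := hN h
    exact ⟨N, h1, h2, h3, h4.trans (le_sup_right.trans (le_sup_left.trans (le_pureClosure _)))⟩)
  have hF := hF fun g => by
    obtain ⟨β, hβ, rfl⟩ := hx g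
    exact ⟨Order.succ β, (Cardinal.isSuccLimit_omega 1).succ_lt hβ, (hspec β hβ).1⟩
  obtain ⟨V, _, _, j, hj, hV, hjV⟩ := exists_divisible_hull (R := R) (G := G)
  -- The recursion runs over all ordinals, hence the guard `δ < ω₁`. If the current `f` has a
  -- forbidden lift `h₀`, it is replaced by `f + ψ`: a forbidden lift `h₁` of that would make `h₁ -
  -- h₀` a lift of `ψ`.
  obtain ⟨f, hf⟩ := (baer_quotient hV (LinearMap.range j)).exists_forall F
    (fun δ => F (Order.succ δ)) (fun δ => hmono (Order.le_succ δ))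
    (fun γ δ h => hmono (Order.succ_le_of_lt h))
    (fun δ f => δ < ω₁ → C ≤ F δ → ¬ ∃ h : F (Order.succ δ) →ₗ[R] V,
      (∀ x, (LinearMap.range j).mkQ (h x) = f x) ∧
      ∀ x : F (Order.succ δ), (x : G) ∈ F δ → ∃ b : R, b ≠ 0 ∧ ∃ y ∈ F δ, b • h x = j y)
    (fun δ f g hfg hPf h1 h2 ⟨h, hh, hh'⟩ => hPf h1 h2
      ⟨h, fun x => (hh x).trans (hfg x x.2).symm, hh'⟩) (by
    intro δ f
    by_cases hcase : δ < ω₁ ∧ C ≤ F δ ∧ ∃ h : F (Order.succ δ) →ₗ[R] V,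
        (∀ x, (LinearMap.range j).mkQ (h x) = f x) ∧
        ∀ x : F (Order.succ δ), (x : G) ∈ F δ → ∃ b : R, b ≠ 0 ∧ ∃ y ∈ F δ, b • h x = j y
    swap
    · exact ⟨f, fun _ _ => rfl, fun h1 h2 h3 => hcase ⟨h1, h2, h3⟩⟩
    obtain ⟨hδ, hCδ, h₀, hlift₀, hhull₀⟩ := hcase
    have := hFc δ hδ
    obtain ⟨N, hNc, hNr, hNf, hNF⟩ := (hspec δ hδ).2 (hC (F δ) hCδ (hFc δ hδ))
    obtain ⟨ψ, hψF, hψ⟩ := exists_obstruction j hj hV (F δ) (hF.pure δ hδ)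
      (hrad (F δ) (hFc δ hδ)) N hNr hNf
    refine ⟨f + ψ, fun x hx => by rw [LinearMap.add_apply, hψF x hx, add_zero],
      fun _ _ ⟨h₁, hlift₁, hhull₁⟩ => hψ ⟨(h₁ - h₀) ∘ₗ Submodule.inclusion hNF,
        fun x => ?_, fun x hx => ?_⟩⟩
    · rw [LinearMap.comp_apply, LinearMap.sub_apply, map_sub, hlift₁, hlift₀,
        LinearMap.add_apply, add_sub_cancel_left]
      rfl
    · obtain ⟨b₁, hb₁, y₁, hy₁, hxy₁⟩ := hhull₁ (Submodule.inclusion hNF x) hx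
      obtain ⟨b₀, hb₀, y₀, hy₀, hxy₀⟩ := hhull₀ (Submodule.inclusion hNF x) hx
      refine ⟨b₁ * b₀, mul_ne_zero hb₁ hb₀, b₀ • y₁ - b₁ • y₀,
        (F δ).sub_mem ((F δ).smul_mem _ hy₁) ((F δ).smul_mem _ hy₀), ?_⟩
      rw [LinearMap.comp_apply, LinearMap.sub_apply, smul_sub, map_sub, map_smul, map_smul,
        ← hxy₁, ← hxy₀, smul_smul, smul_smul, mul_comm b₀ b₁])
  obtain ⟨h, hh⟩ := hs.exists_lift j hj f
  choose b hb y hy using fun g => hjV (h g)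
  -- Closing off: `y g` is the numerator of `h g`, and `F α` is countable, so its numerators lie in
  -- some later stage `F (c α)`.
  have hclose : ∀ α : Set.Iio (ω₁ : Ordinal.{0}), ∃ β : Set.Iio (ω₁ : Ordinal.{0}),
      ∀ g ∈ F α, y g ∈ F β := by
    rintro ⟨α, hα⟩
    have := hFc α hα
    obtain ⟨β, hβ, hβy⟩ := hF.exists_le ((Set.to_countable (F α : Set G)).image y)
    exact ⟨⟨β, hβ⟩, fun g hg => hβy ⟨g, hg, rfl⟩⟩
  choose c hc using hclose
  obtain ⟨δ₀, hδ₀, hCδ₀⟩ := hF.exists_le (Set.to_countable (C : Set G))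
  -- Starting at the successor of `δ₀` makes `δ` nonzero, as `hunion` requires. `δ` need not be a
  -- limit: every element of `F δ` already lies in some `F (a n)`.
  let a : ℕ → Set.Iio (ω₁ : Ordinal.{0}) := fun n => Nat.rec
    ⟨Order.succ δ₀, (Cardinal.isSuccLimit_omega 1).succ_lt hδ₀⟩ (fun _ => c) n
  let δ : Ordinal.{0} := ⨆ n, (a n).1
  have hδ : δ < ω₁ := Ordinal.iSup_lt_omega_one fun n => (a n).2
  have haδ : ∀ n, (a n).1 ≤ δ := fun n =>
    Ordinal.le_iSup (fun n => (a n).1) n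
  have hδ₀δ : δ₀ < δ := (Order.lt_succ δ₀).trans_le (haδ 0)
  refine hf δ hδ (le_trans hCδ₀ (hmono hδ₀δ.le)) ⟨h ∘ₗ (F (Order.succ δ)).subtype,
    fun x => hh x, fun x hx => ⟨b x, hb x, y x, ?_, hy x⟩⟩
  obtain ⟨β, hβ, hxβ⟩ := hunion δ (ne_bot_of_gt hδ₀δ) x hx
  obtain ⟨n, hn⟩ := (Ordinal.lt_iSup_iff).1 hβ
  exact hmono (haδ (n + 1)) (hc (a n) x (hmono (Order.succ_le_of_lt hn) hxβ))

theorem IsSplitter.isTypeI_or_isTypeII (hs : IsSplitter R G) (hG : IsAlephOneFree R G)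
    (hcard : #G = ℵ₁) : IsTypeI R G ∨ IsTypeII R G := by
  by_cases hII : ∀ C : Submodule R G, Countable C →
      ∃ H : Submodule R G, C ≤ H ∧ Countable H ∧ IsAlephOneFree R (G ⧸ H)
  · exact Or.inr (isTypeII_of_forall hG hcard hII)
  · push Not at hII
    obtain ⟨C, hC, hCH⟩ := hII
    obtain ⟨H, hH, hrad⟩ := hs.exists_countableRadical_eq_top hG hcard C hCH
    exact Or.inl (isTypeI_of_countableRadical_eq_top hG hcard H hrad)

end Main

/-! ### Subrings of the rationals -/

section SubringRat

/-- Subrings of the rationals are principal ideal domains. -/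
instance isPrincipalIdealRing_subring_rat (R : Subring ℚ) : IsPrincipalIdealRing R := by
  -- By Bézout, `a * num + b * den = 1` gives `a * x + b = 1 / den`, so denominators are units of
  -- `R` and each ideal is generated by its integers.
  have hinv : ∀ x : R, ∃ v : R, v * ((x : ℚ).den : R) = 1 := by
    intro x
    have hcop : IsCoprime ((x : ℚ).num) ((x : ℚ).den : ℤ) :=
      Int.isCoprime_iff_gcd_eq_one.2 (by simpa [Int.gcd] using (x : ℚ).reduced)
    obtain ⟨a, b, hab⟩ := hcop
    refine ⟨(a : R) * x + b, Subtype.ext ?_⟩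
    push_cast
    rw [add_mul, mul_assoc, Rat.mul_den_eq_num]
    exact_mod_cast hab
  refine ⟨fun I => ?_⟩
  obtain ⟨d, hd⟩ := IsPrincipalIdealRing.principal (I.comap (Int.castRingHom R))
  refine ⟨(d : R), le_antisymm (fun x hx => ?_) ?_⟩
  · have hxd : x * ((x : ℚ).den : R) = ((x : ℚ).num : R) := Subtype.ext (by
      push_cast; exact Rat.mul_den_eq_num _)
    have hnum : (x : ℚ).num ∈ I.comap (Int.castRingHom R) := by
      rw [Ideal.mem_comap, eq_intCast, ← hxd]
      exact I.mul_mem_right _ hx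
    rw [hd] at hnum
    obtain ⟨k, hk⟩ := Submodule.mem_span_singleton.1 hnum
    obtain ⟨v, hv⟩ := hinv x
    refine Submodule.mem_span_singleton.2 ⟨v * k, ?_⟩
    have hk' : (k : R) * d = ((x : ℚ).num : R) := by rw [← hk]; push_cast [smul_eq_mul]; rfl
    rw [smul_eq_mul, mul_assoc, hk', ← hxd, mul_comm x, ← mul_assoc, hv, one_mul]
  · rw [Submodule.span_singleton_le_iff_mem]
    have : d ∈ I.comap (Int.castRingHom R) := hd ▸ Submodule.mem_span_singleton_self d
    simpa using this

end SubringRat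

theorem theorem7p1 (R : Subring ℚ) (G : Type u) [AddCommGroup G] [Module R G]
    (hG : IsTypeIII R G) : ¬ IsSplitter R G := by
  intro hs
  exact (hs.isTypeI_or_isTypeII hG.alephOneFree hG.card_eq).elim hG.not_typeI hG.not_typeII
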